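/- Let $\mathcal{C}=\{0,1\}^{\mathbb{N}}$ be the Cantor space, and for a set $S$ let $\mathcal{C}^S$ be the space of all functions $S\to\mathcal{C}$ with the product topology. For a function $\psi\colon S\to\{0,1\}^*$ into the finite binary words with $\psi(s)$ empty for all but finitely many $s\in S$, the dyadic brick of $\psi$ is $$B(\psi)=\{\kappa\in\mathcal{C}^S \mid \psi(s)\text{ is a prefix of }\kappa(s)\text{ for each }s\in S\},$$ and $h_\psi\colon\mathcal{C}^S\to B(\psi)$ is the homeomorphism $h_\psi(\kappa)(s)=\psi(s)\cdot\kappa(s)$ (concatenation). Let $G$ be a group acting on $S$. For $\gamma\in G$ let $\tau_\gamma\colon\mathcal{C}^S\to\mathcal{C}^S$ be the homeomorphism $\tau_\gamma(\kappa)(s)=\kappa(\gamma^{-1}s)$. The twisted Brin--Thompson group $S\mathrm{V}_G$ is the group of all homeomorphisms $f$ of $\mathcal{C}^S$ for which there are a natural number $n$, two partitions $B(\varphi_1),\dots,B(\varphi_n)$ and $B(\psi_1),\dots,B(\psi_n)$ of $\mathcal{C}^S$ into dyadic bricks, and elements $\gamma_1,\dots,\gamma_n\in G$ such that $f$ restricted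 to $B(\varphi_i)$ equals $h_{\psi_i}\circ\tau_{\gamma_i}\circ h_{\varphi_i}^{-1}$ for each $i$. **Lemma.** For any group $G$ acting faithfully on a non-empty (possibly uncountable) set $S$, the group $S\mathrm{V}_G$ is simple. -/

import Mathlib

universe u v

namespace TwistedBrinThompson

/-- The Cantor cube over `S`: all functions from `S` to the Cantor space of infinite binary
sequences, with the product topology. -/
abbrev CantorCube (S : Type v) : Type v := S → ℕ → Bool

/-- Concatenation of a finite word with an infinite sequence. -/
def prepend (w : List Bool) (x : ℕ → Bool) : ℕ → Bool :=
  fun n => if h : n < w.length then w[n] else x (n - w.length)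

/-- The finite word `w` is a prefix of the infinite sequence `x`. -/
def IsPrefixOf (w : List Bool) (x : ℕ → Bool) : Prop :=
  ∀ (n : ℕ) (h : n < w.length), x n = w[n]

section Cube

variable {S : Type v}

/-- All but finitely many of the words `ψ s` are empty. -/
def FiniteSupport (ψ : S → List Bool) : Prop := {s | ψ s ≠ []}.Finite

/-- The dyadic brick `B(ψ)` of a (finitely supported) function `ψ`. -/
def brick (ψ : S → List Bool) : Set (CantorCube S) :=
  {κ | ∀ s, IsPrefixOf (ψ s) (κ s)}

/-- The canonical map `h_ψ : C^S → B(ψ)`, regarded as a map into `C^S`. -/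
def brickMap (ψ : S → List Bool) (κ : CantorCube S) : CantorCube S :=
  fun s => prepend (ψ s) (κ s)

/-- The dyadic bricks `B(φ i)` form a partition of the Cantor cube. (Bricks are never empty, so
disjointness includes that they are pairwise distinct.) -/
structure IsBrickPartition {ι : Type} (φ : ι → S → List Bool) : Prop where
  finiteSupport : ∀ i, FiniteSupport (φ i)
  disjoint : ∀ i j, i ≠ j → Disjoint (brick (φ i)) (brick (φ j))
  cover : ⋃ i, brick (φ i) = Set.univ

end Cube

section Twist

variable {G : Type u} {S : Type v} [Group G] [MulAction G S]

/-- The twist homeomorphism `τ_γ` of the Cantor cube, permuting the coordinates by `γ`. -/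
def twist (γ : G) (κ : CantorCube S) : CantorCube S := fun s => κ (γ⁻¹ • s)

/-- `B(φ i)` and `B(ψ i)` are partitions of the Cantor cube into dyadic bricks, and `f` maps each
`B(φ i)` to `B(ψ i)` by the canonical twist homeomorphism `h_{ψ i} ∘ τ_{γ i} ∘ h_{φ i}⁻¹`. -/
structure IsPiecewiseTwist {ι : Type} (φ ψ : ι → S → List Bool) (γ : ι → G)
    (f : CantorCube S → CantorCube S) : Prop where
  domain : IsBrickPartition φ
  image : IsBrickPartition ψ
  map_brick : ∀ i κ, f (brickMap (φ i) κ) = brickMap (ψ i) (twist (γ i) κ)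

end Twist

/-! Facts needed to see that these homeomorphisms form a group. -/

theorem prepend_append (w v : List Bool) (x : ℕ → Bool) :
    prepend (w ++ v) x = prepend w (prepend v x) := by
  funext n
  simp only [prepend, List.length_append, List.getElem_append]
  split_ifs <;> first | rfl | omega | (congr 1; omega)

theorem isPrefixOf_iff {w : List Bool} {x : ℕ → Bool} :
    IsPrefixOf w x ↔ ∃ y, prepend w y = x := by
  constructor
  · intro h
    refine ⟨fun n => x (n + w.length), ?_⟩
    funext n
    unfold prepend
    split_ifs with hn
    · exact (h n hn).symm
    · exact congrArg x (Nat.sub_add_cancel (Nat.le_of_not_lt hn))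
  · rintro ⟨y, rfl⟩ n hn
    simp [prepend, hn]

theorem append_drop_eq {w v : List Bool} {x : ℕ → Bool} (hw : IsPrefixOf w x)
    (hv : IsPrefixOf v x) : w ++ v.drop w.length = v ++ w.drop v.length := by
  apply List.ext_getElem
  · simp; omega
  · intro n h1 h2
    simp only [List.length_append, List.length_drop] at h1 h2
    simp only [List.getElem_append, List.getElem_drop]
    split_ifs with h3 h4 h4
    · rw [← hw n h3, ← hv n h4]
    · congr 1; omega
    · congr 1; omega
    · omega

section Cube

variable {S : Type v}

theorem mem_brick_iff {ψ : S → List Bool} {κ : CantorCube S} :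
    κ ∈ brick ψ ↔ ∃ μ, brickMap ψ μ = κ := by
  constructor
  · intro h
    choose y hy using fun s => isPrefixOf_iff.1 (h s)
    exact ⟨y, funext hy⟩
  · rintro ⟨μ, rfl⟩ s
    exact isPrefixOf_iff.2 ⟨μ s, rfl⟩

/-- If `B(ψ)` and `B(φ)` meet, then their intersection is `B(meet ψ φ)`. -/
def meet (ψ φ : S → List Bool) : S → List Bool := fun s => ψ s ++ (φ s).drop (ψ s).length

theorem meet_comm {ψ φ : S → List Bool} (h : (brick ψ ∩ brick φ).Nonempty) :
    meet ψ φ = meet φ ψ := by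
  obtain ⟨x, h1, h2⟩ := h
  exact funext fun s => append_drop_eq (h1 s) (h2 s)

theorem brickMap_append (ψ a : S → List Bool) (κ : CantorCube S) :
    brickMap (fun s => ψ s ++ a s) κ = brickMap ψ (brickMap a κ) :=
  funext fun s => prepend_append (ψ s) (a s) (κ s)

theorem brick_meet_subset (ψ φ : S → List Bool) : brick (meet ψ φ) ⊆ brick ψ := by
  intro x hx
  obtain ⟨μ, rfl⟩ := mem_brick_iff.1 hx
  exact mem_brick_iff.2 ⟨_, (brickMap_append _ _ _).symm⟩

theorem brick_meet {ψ φ : S → List Bool} (h : (brick ψ ∩ brick φ).Nonempty) :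
    brick (meet ψ φ) = brick ψ ∩ brick φ := by
  apply Set.Subset.antisymm
  · exact Set.subset_inter (brick_meet_subset _ _) (meet_comm h ▸ brick_meet_subset φ ψ)
  · rintro x ⟨h1, h2⟩ s n hn
    simp only [meet, List.length_append, List.length_drop] at hn
    simp only [meet, List.getElem_append, List.getElem_drop]
    split_ifs with h3
    · exact h1 s n h3
    · rw [h2 s n (by omega)]
      congr 1; omega

theorem FiniteSupport.append {ψ a : S → List Bool} (hψ : FiniteSupport ψ)
    (ha : FiniteSupport a) : FiniteSupport fun s => ψ s ++ a s := by
  refine (Set.Finite.union hψ ha).subset fun s hs => ?_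
  by_contra h
  simp only [Set.mem_union, Set.mem_ofPred_eq, not_or, not_not] at h
  exact hs (show ψ s ++ a s = [] by rw [h.1, h.2]; rfl)

theorem FiniteSupport.drop {φ : S → List Bool} (hφ : FiniteSupport φ) (k : S → ℕ) :
    FiniteSupport fun s => (φ s).drop (k s) := by
  refine Set.Finite.subset hφ fun s hs h => hs ?_
  simp only [h, List.drop_nil]

theorem IsBrickPartition.comap {ι : Type} {φ ψ : ι → S → List Bool} (hψ : IsBrickPartition ψ)
    (hφ : ∀ i, FiniteSupport (φ i)) (f : CantorCube S → CantorCube S)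
    (h : ∀ i, brick (φ i) = f ⁻¹' brick (ψ i)) : IsBrickPartition φ where
  finiteSupport := hφ
  disjoint i j hij := by
    rw [h, h]
    exact (hψ.disjoint i j hij).preimage f
  cover := by
    simp only [h, ← Set.preimage_iUnion, hψ.cover, Set.preimage_univ]

/-- The pairs of bricks of two partitions that meet. -/
abbrev MeetIndex {ι κ : Type} (ψ : ι → S → List Bool) (φ : κ → S → List Bool) : Type :=
  {p : ι × κ // (brick (ψ p.1) ∩ brick (φ p.2)).Nonempty}

theorem IsBrickPartition.meet {ι κ : Type} {ψ : ι → S → List Bool} {φ : κ → S → List Bool}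
    (hψ : IsBrickPartition ψ) (hφ : IsBrickPartition φ) :
    IsBrickPartition fun p : MeetIndex ψ φ => meet (ψ p.1.1) (φ p.1.2) where
  finiteSupport p := (hψ.finiteSupport _).append ((hφ.finiteSupport _).drop _)
  disjoint := by
    rintro ⟨⟨i, j⟩, hp⟩ ⟨⟨i', j'⟩, hq⟩ hne
    rw [brick_meet hp, brick_meet hq]
    by_cases h : i = i'
    · have hj : j ≠ j' := by
        rintro rfl
        exact hne (by subst h; rfl)
      exact (hφ.disjoint j j' hj).mono Set.inter_subset_right Set.inter_subset_right
    · exact (hψ.disjoint i i' h).mono Set.inter_subset_left Set.inter_subset_left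
  cover := by
    refine Set.eq_univ_of_forall fun x => ?_
    obtain ⟨i, hi⟩ := Set.mem_iUnion.1 (hψ.cover ▸ Set.mem_univ x)
    obtain ⟨j, hj⟩ := Set.mem_iUnion.1 (hφ.cover ▸ Set.mem_univ x)
    refine Set.mem_iUnion.2 ⟨⟨(i, j), x, hi, hj⟩, ?_⟩
    rw [brick_meet ⟨x, hi, hj⟩]
    exact ⟨hi, hj⟩

theorem IsBrickPartition.reindex {ι κ : Type} {φ : ι → S → List Bool} (h : IsBrickPartition φ)
    (e : κ ≃ ι) : IsBrickPartition fun k => φ (e k) where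
  finiteSupport k := h.finiteSupport _
  disjoint i j hij := h.disjoint _ _ fun h' => hij (e.injective h')
  cover := by
    rw [← h.cover]
    exact e.surjective.iUnion_comp fun i => brick (φ i)

end Cube

section Twist

variable {G : Type u} {S : Type v} [Group G] [MulAction G S]

theorem twist_mul (γ δ : G) (κ : CantorCube S) : twist (γ * δ) κ = twist γ (twist δ κ) := by
  funext s
  simp [twist, mul_smul]

theorem twist_one (κ : CantorCube S) : twist (1 : G) κ = κ := by
  funext s
  simp [twist]

theorem twist_brickMap (γ : G) (a : S → List Bool) (κ : CantorCube S) :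
    twist γ (brickMap a κ) = brickMap (fun s => a (γ⁻¹ • s)) (twist γ κ) := rfl

theorem FiniteSupport.smul {a : S → List Bool} (ha : FiniteSupport a) (γ : G) :
    FiniteSupport fun s => a (γ • s) :=
  Set.Finite.preimage (f := fun s : S => γ • s) (MulAction.injective γ).injOn ha

theorem brick_eq_preimage {f : CantorCube S → CantorCube S} (hf : Function.Injective f)
    {φ ψ : S → List Bool} {γ : G}
    (h : ∀ κ, f (brickMap φ κ) = brickMap ψ (twist γ κ)) : brick φ = f ⁻¹' brick ψ := by
  ext x
  rw [Set.mem_preimage, mem_brick_iff, mem_brick_iff]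
  constructor
  · rintro ⟨μ, rfl⟩
    exact ⟨_, (h μ).symm⟩
  · rintro ⟨μ, hμ⟩
    refine ⟨twist γ⁻¹ μ, hf ?_⟩
    rw [h, ← twist_mul, mul_inv_cancel, twist_one, hμ]

theorem map_symm {f : CantorCube S ≃ₜ CantorCube S} {φ ψ : S → List Bool} {γ : G}
    (h : ∀ κ, f (brickMap φ κ) = brickMap ψ (twist γ κ)) (κ : CantorCube S) :
    f.symm (brickMap ψ κ) = brickMap φ (twist γ⁻¹ κ) := by
  rw [Homeomorph.symm_apply_eq, h, ← twist_mul, mul_inv_cancel, twist_one]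

theorem IsPiecewiseTwist.symm {ι : Type} {φ ψ : ι → S → List Bool} {γ : ι → G}
    {f : CantorCube S ≃ₜ CantorCube S} (h : IsPiecewiseTwist φ ψ γ f) :
    IsPiecewiseTwist ψ φ (fun i => (γ i)⁻¹) f.symm :=
  ⟨h.image, h.domain, fun i κ => map_symm (h.map_brick i) κ⟩

theorem IsPiecewiseTwist.comp {ι ι' : Type} {φ ψ : ι → S → List Bool} {γ : ι → G}
    {φ' ψ' : ι' → S → List Bool} {γ' : ι' → G} {f g : CantorCube S ≃ₜ CantorCube S}
    (hf : IsPiecewiseTwist φ ψ γ f) (hg : IsPiecewiseTwist φ' ψ' γ' g) :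
    IsPiecewiseTwist (ι := MeetIndex ψ φ')
      (fun p s => φ p.1.1 s ++
        (φ' p.1.2 (γ p.1.1 • s)).drop (ψ p.1.1 (γ p.1.1 • s)).length)
      (fun p s => ψ' p.1.2 s ++
        (ψ p.1.1 ((γ' p.1.2)⁻¹ • s)).drop (φ' p.1.2 ((γ' p.1.2)⁻¹ • s)).length)
      (fun p => γ' p.1.2 * γ p.1.1) (g ∘ f) := by
  have hM := hf.image.meet hg.domain
  have h1 : ∀ (p : MeetIndex ψ φ') κ, f (brickMap (fun s => φ p.1.1 s ++
      (φ' p.1.2 (γ p.1.1 • s)).drop (ψ p.1.1 (γ p.1.1 • s)).length) κ) =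
      brickMap (meet (ψ p.1.1) (φ' p.1.2)) (twist (γ p.1.1) κ) := by
    intro p κ
    rw [brickMap_append, hf.map_brick, twist_brickMap]
    simp only [smul_inv_smul]
    exact (brickMap_append _ _ _).symm
  have h2 : ∀ (p : MeetIndex ψ φ') κ, g (brickMap (meet (ψ p.1.1) (φ' p.1.2)) κ) =
      brickMap (fun s => ψ' p.1.2 s ++
        (ψ p.1.1 ((γ' p.1.2)⁻¹ • s)).drop (φ' p.1.2 ((γ' p.1.2)⁻¹ • s)).length)
        (twist (γ' p.1.2) κ) := by
    intro p κ
    rw [meet_comm p.2]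
    unfold meet
    rw [brickMap_append, hg.map_brick, twist_brickMap, brickMap_append]
  refine ⟨?_, ?_, ?_⟩
  · refine hM.comap (fun p => (hf.domain.finiteSupport _).append ?_) f
      fun p => brick_eq_preimage f.injective (h1 p)
    exact ((hg.domain.finiteSupport p.1.2).drop fun s => (ψ p.1.1 s).length).smul (γ p.1.1)
  · refine hM.comap (fun p => (hg.image.finiteSupport _).append ?_) g.symm
      fun p => brick_eq_preimage g.symm.injective (map_symm (h2 p))
    exact ((hf.image.finiteSupport p.1.1).drop fun s => (φ' p.1.2 s).length).smul (γ' p.1.2)⁻¹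
  · intro p κ
    rw [Function.comp_apply, h1, h2, twist_mul]

theorem IsPiecewiseTwist.exists_fin {ι : Type} [Finite ι] {φ ψ : ι → S → List Bool} {γ : ι → G}
    {f : CantorCube S → CantorCube S} (h : IsPiecewiseTwist φ ψ γ f) :
    ∃ (n : ℕ) (φ' ψ' : Fin n → S → List Bool) (γ' : Fin n → G),
      IsPiecewiseTwist φ' ψ' γ' f := by
  obtain ⟨n, ⟨e⟩⟩ := Finite.exists_equiv_fin ι
  exact ⟨n, _, _, _, h.domain.reindex e.symm, h.image.reindex e.symm,
    fun k κ => h.map_brick (e.symm k) κ⟩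

theorem isBrickPartition_nil : IsBrickPartition fun (_ : Fin 1) (_ : S) => ([] : List Bool) where
  finiteSupport _ := by simp [FiniteSupport]
  disjoint i j hij := absurd (Subsingleton.elim i j) hij
  cover := Set.eq_univ_of_forall fun x => Set.mem_iUnion.2
    ⟨0, fun s n hn => absurd hn (Nat.not_lt_zero n)⟩

theorem isPiecewiseTwist_id : IsPiecewiseTwist (fun (_ : Fin 1) (_ : S) => ([] : List Bool))
    (fun _ _ => []) (fun _ => (1 : G)) id where
  domain := isBrickPartition_nil
  image := isBrickPartition_nil
  map_brick _ κ := by rw [twist_one]; rfl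

end Twist

end TwistedBrinThompson

/-- The twisted Brin–Thompson group `SV_G`, as a subgroup of the homeomorphism group of the
Cantor cube: all homeomorphisms that are obtained from two partitions of the Cantor cube into the
same finite number of dyadic bricks by mapping the `i`-th brick of the first partition to the
`i`-th brick of the second one via the canonical twist homeomorphism of some `γ i : G`. -/
def twistedBrinThompsonGroup (G : Type u) (S : Type v) [Group G] [MulAction G S] :
    Subgroup (TwistedBrinThompson.CantorCube S ≃ₜ TwistedBrinThompson.CantorCube S) where
  carrier := {f | ∃ (n : ℕ) (φ ψ : Fin n → S → List Bool) (γ : Fin n → G),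
    TwistedBrinThompson.IsPiecewiseTwist φ ψ γ f}
  mul_mem' := by
    rintro g f ⟨m, φ', ψ', γ', hg⟩ ⟨n, φ, ψ, γ, hf⟩
    exact (hf.comp hg).exists_fin
  one_mem' := ⟨1, _, _, _, TwistedBrinThompson.isPiecewiseTwist_id⟩
  inv_mem' := by
    rintro f ⟨n, φ, ψ, γ, hf⟩
    exact ⟨n, _, _, _, hf.symm⟩

/-! Let `M` be a group of permutations of the cube that is normalized by $S\mathrm{V}_G$ and
contains some $f\ne 1$ of $S\mathrm{V}_G$; it is shown that `M` contains all of $S\mathrm{V}_G$.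
Three kinds of elements matter: exchanges of two disjoint bricks (`swap`), baker's maps moving the
first letter of one coordinate to another (`baker`), and twists (`twistPerm`), the last two copied
into bricks by `onBrick`.

Exchanges. Some brick $D$ is moved off itself by $f$ (`exists_moved_brick`). If $g,h$ are supported
in $D$, then $f g^{-1}f^{-1}$ lives on $f(D)$ and commutes with $h$, so $[g,h]=[[g,f],h]\in M$
(`commutator_mem_of_moved`). The exchange of the two halves of $D$ is such a commutator. Conjugation
carries it to every exchange of two bricks that leave room for a third, and every exchange is a
product of two of these (`swap_mem`).

Baker's maps and twists. Write $g_\varphi$ for the copy of $g$ in $B(\varphi)$. Exchanges conjugate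
copies in disjoint bricks into each other, so modulo `M` all copies in proper bricks are one element
$x$. A baker's map is, up to an exchange, the product of its copies in two halves (`baker_eq_mul`);
a twist is so up to a baker's map (`twistPerm_eq_mul`). Hence $x=x^2$ and $x=1$ modulo `M`
(`onBrick_mem`).

Generation. After refinement, the domain and image partitions of any element both arise from the
cube by successive halving. Baker's maps and exchanges carry a standard comb-shaped partition to
either of them, so up to these generators the element preserves each brick and acts on it by a twist
(`permGroup_le`). -/

namespace TwistedBrinThompson

/-! ### Concatenation and halving of bricks. -/

section Bricks

variable {S : Type v}

/-- Pointwise concatenation of words. -/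
def cat (φ ψ : S → List Bool) : S → List Bool := fun s => φ s ++ ψ s

open Classical in
/-- The function with value `w` at `s` and empty words elsewhere. -/
noncomputable def single (s : S) (w : List Bool) : S → List Bool := fun r => if r = s then w else []

/-- The function with empty words everywhere, whose brick is the whole cube. -/
def root : S → List Bool := fun _ => []

theorem cat_root (φ : S → List Bool) : cat φ root = φ := funext fun _ => List.append_nil _

theorem root_cat (φ : S → List Bool) : cat root φ = φ := rfl

theorem single_cat_comm {s t : S} (h : s ≠ t) (u w : List Bool) :
    cat (single s u) (single t w) = cat (single t w) (single s u) := by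
  funext r
  simp only [cat, single]
  split_ifs with h1 h2
  · exact absurd (h1.symm.trans h2) h
  all_goals simp

theorem FiniteSupport.cat {φ ψ : S → List Bool} (hφ : FiniteSupport φ) (hψ : FiniteSupport ψ) :
    FiniteSupport (cat φ ψ) := hφ.append hψ

theorem FiniteSupport.root : FiniteSupport (root : S → List Bool) := by
  simp [FiniteSupport, TwistedBrinThompson.root]

theorem FiniteSupport.single (s : S) (w : List Bool) : FiniteSupport (single s w) := by
  refine (Set.finite_singleton s).subset fun r hr => ?_
  by_contra h
  exact hr (if_neg h)

theorem FiniteSupport.cut {φ : S → List Bool} (hφ : FiniteSupport φ) (s : S) (w : List Bool) :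
    FiniteSupport (TwistedBrinThompson.cat φ (TwistedBrinThompson.single s w)) :=
  hφ.cat (.single s w)

theorem brickMap_cat (φ a : S → List Bool) (κ : CantorCube S) :
    brickMap (cat φ a) κ = brickMap φ (brickMap a κ) := brickMap_append φ a κ

theorem prepend_injective (w : List Bool) : Function.Injective (prepend w) := by
  intro x y h
  funext n
  have := congrFun h (n + w.length)
  simpa [prepend] using this

theorem brickMap_injective (φ : S → List Bool) : Function.Injective (brickMap φ) :=
  fun _ _ h => funext fun s => prepend_injective (φ s) (congrFun h s)

theorem brickMap_mem (φ : S → List Bool) (κ : CantorCube S) : brickMap φ κ ∈ brick φ :=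
  mem_brick_iff.2 ⟨κ, rfl⟩

theorem brick_root : brick (root : S → List Bool) = Set.univ :=
  Set.eq_univ_of_forall fun κ => brickMap_mem root κ

theorem brick_nonempty (φ : S → List Bool) : (brick φ).Nonempty :=
  ⟨_, brickMap_mem φ fun _ _ => false⟩

theorem not_disjoint_self (φ : S → List Bool) : ¬ Disjoint (brick φ) (brick φ) := fun h =>
  (brick_nonempty φ).ne_empty (disjoint_self.1 h)

theorem brick_cat_subset (φ a : S → List Bool) : brick (cat φ a) ⊆ brick φ := by
  intro x hx
  obtain ⟨κ, rfl⟩ := mem_brick_iff.1 hx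
  rw [brickMap_cat]
  exact brickMap_mem _ _

theorem disjoint_cat_left {φ ψ : S → List Bool} (h : Disjoint (brick φ) (brick ψ))
    (a : S → List Bool) : Disjoint (brick (cat φ a)) (brick ψ) :=
  h.mono_left (brick_cat_subset φ a)

theorem disjoint_cat_right {φ ψ : S → List Bool} (h : Disjoint (brick φ) (brick ψ))
    (a : S → List Bool) : Disjoint (brick φ) (brick (cat ψ a)) :=
  h.mono_right (brick_cat_subset ψ a)

theorem disjoint_cat {φ ψ : S → List Bool} (h : Disjoint (brick φ) (brick ψ))
    (a b : S → List Bool) : Disjoint (brick (cat φ a)) (brick (cat ψ b)) :=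
  disjoint_cat_left (disjoint_cat_right h b) a

theorem disjoint_cat_cat (χ : S → List Bool) {φ ψ : S → List Bool}
    (h : Disjoint (brick φ) (brick ψ)) : Disjoint (brick (cat χ φ)) (brick (cat χ ψ)) := by
  refine Set.disjoint_left.2 fun x h1 h2 => ?_
  obtain ⟨κ, rfl⟩ := mem_brick_iff.1 h1
  obtain ⟨μ, hμ⟩ := mem_brick_iff.1 h2
  rw [brickMap_cat, brickMap_cat] at hμ
  exact Set.disjoint_left.1 h (brickMap_mem φ κ) (brickMap_injective χ hμ ▸ brickMap_mem ψ μ)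

theorem disjoint_single (s : S) {b c : Bool} (h : b ≠ c) :
    Disjoint (brick (single s [b])) (brick (single s [c])) := by
  refine Set.disjoint_left.2 fun x h1 h2 => h ?_
  have e1 := h1 s 0 (by simp [single])
  have e2 := h2 s 0 (by simp [single])
  simp only [single] at e1 e2
  simp_all

theorem disjoint_cut (φ : S → List Bool) (s : S) {b c : Bool} (h : b ≠ c) :
    Disjoint (brick (cat φ (single s [b]))) (brick (cat φ (single s [c]))) :=
  disjoint_cat_cat φ (disjoint_single s h)

theorem exists_eq_prepend (x : ℕ → Bool) : ∃ b y, x = prepend [b] y := by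
  refine ⟨x 0, fun n => x (n + 1), ?_⟩
  funext n
  cases n <;> simp [prepend]

theorem exists_brickMap_single (s : S) (κ : CantorCube S) :
    ∃ b μ, κ = brickMap (single s [b]) μ := by
  classical
  obtain ⟨b, y, h⟩ := exists_eq_prepend (κ s)
  refine ⟨b, Function.update κ s y, ?_⟩
  funext r
  by_cases hr : r = s
  · subst hr
    simp [brickMap, single, h]
  · simp only [brickMap, single, hr, if_false, Function.update_of_ne hr]
    rfl

theorem exists_brickMap_cut {φ : S → List Bool} {x : CantorCube S} (s : S) (hx : x ∈ brick φ) :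
    ∃ b μ, x = brickMap (cat φ (single s [b])) μ := by
  obtain ⟨κ, rfl⟩ := mem_brick_iff.1 hx
  obtain ⟨b, μ, rfl⟩ := exists_brickMap_single s κ
  exact ⟨b, μ, (brickMap_cat _ _ _).symm⟩

/-- The brick of `φ` contains that of `w` as soon as all words of `φ` are prefixes of those
of `w`. -/
theorem exists_eq_cat {φ w : S → List Bool} (h : ∀ s, φ s <+: w s) : ∃ a, w = cat φ a := by
  choose a ha using h
  exact ⟨a, funext fun s => (ha s).symm⟩

theorem isPrefix_of_mem {u w : List Bool} {x : ℕ → Bool} (hu : IsPrefixOf u x)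
    (hw : IsPrefixOf w x) (h : u.length ≤ w.length) : u <+: w := by
  rw [List.prefix_iff_getElem]
  exact ⟨h, fun n hn => (hu n hn).symm.trans (hw n (by omega))⟩

theorem FiniteSupport.of_cat {φ a : S → List Bool}
    (h : FiniteSupport (TwistedBrinThompson.cat φ a)) : FiniteSupport a := by
  refine Set.Finite.subset h fun s hs h' => hs ?_
  exact (List.append_eq_nil_iff.1 h').2

end Bricks

/-! ### Canonical maps between bricks, copies of permutations inside a brick, and exchanges. -/

section Canonical

variable {G : Type u} {S : Type v} [Group G] [MulAction G S]

/-- The permutation `p` maps `B(φ)` to `B(ψ)` by the canonical twist homeomorphism of `γ`. -/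
def Canon (p : Equiv.Perm (CantorCube S)) (φ ψ : S → List Bool) (γ : G) : Prop :=
  ∀ κ, p (brickMap φ κ) = brickMap ψ (twist γ κ)

theorem twist_brickMap_single (γ : G) (s : S) (w : List Bool) (κ : CantorCube S) :
    twist γ (brickMap (single s w) κ) = brickMap (single (γ • s) w) (twist γ κ) := by
  rw [twist_brickMap]
  congr 1
  funext r
  simp only [single]
  by_cases h : r = γ • s
  · simp [h]
  · rw [if_neg h, if_neg (mt inv_smul_eq_iff.1 h)]

theorem Canon.comp {p q : Equiv.Perm (CantorCube S)} {φ ψ χ : S → List Bool} {γ δ : G}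
    (hp : Canon p φ ψ γ) (hq : Canon q ψ χ δ) : Canon (q * p) φ χ (δ * γ) := fun κ => by
  rw [Equiv.Perm.mul_apply, hp, hq, twist_mul]

theorem Canon.comp_one {p q : Equiv.Perm (CantorCube S)} {φ ψ χ : S → List Bool}
    (hp : Canon p φ ψ (1 : G)) (hq : Canon q ψ χ (1 : G)) : Canon (q * p) φ χ (1 : G) :=
  mul_one (1 : G) ▸ hp.comp hq

theorem Canon.inv {p : Equiv.Perm (CantorCube S)} {φ ψ : S → List Bool} {γ : G}
    (hp : Canon p φ ψ γ) : Canon p⁻¹ ψ φ γ⁻¹ := fun κ => by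
  rw [Equiv.Perm.inv_eq_iff_eq, hp, ← twist_mul, mul_inv_cancel, twist_one]

theorem Canon.inv_one {p : Equiv.Perm (CantorCube S)} {φ ψ : S → List Bool}
    (hp : Canon p φ ψ (1 : G)) : Canon p⁻¹ ψ φ (1 : G) :=
  by simpa using hp.inv

theorem Canon.cat {p : Equiv.Perm (CantorCube S)} {φ ψ : S → List Bool} {γ : G}
    (hp : Canon p φ ψ γ) (a : S → List Bool) :
    Canon p (cat φ a) (cat ψ fun s => a (γ⁻¹ • s)) γ := fun κ => by
  rw [brickMap_cat, hp, twist_brickMap, brickMap_cat]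

theorem Canon.cut {p : Equiv.Perm (CantorCube S)} {φ ψ : S → List Bool} {γ : G}
    (hp : Canon p φ ψ γ) (s : S) (w : List Bool) :
    Canon p (TwistedBrinThompson.cat φ (single s w))
      (TwistedBrinThompson.cat ψ (single (γ • s) w)) γ := fun κ => by
  rw [brickMap_cat, hp, twist_brickMap_single, brickMap_cat]

theorem Canon.cut_one {p : Equiv.Perm (CantorCube S)} {φ ψ : S → List Bool}
    (hp : Canon p φ ψ (1 : G)) (s : S) (w : List Bool) :
    Canon p (TwistedBrinThompson.cat φ (single s w))
      (TwistedBrinThompson.cat ψ (single s w)) (1 : G) := by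
  simpa using hp.cut s w

theorem Canon.one (φ : S → List Bool) : Canon 1 φ φ (1 : G) := fun κ => by
  rw [twist_one]; rfl

theorem Canon.apply_mem_iff {p : Equiv.Perm (CantorCube S)} {φ ψ : S → List Bool} {γ : G}
    (hp : Canon p φ ψ γ) (x : CantorCube S) : p x ∈ brick ψ ↔ x ∈ brick φ := by
  rw [brick_eq_preimage p.injective hp]; rfl

theorem Canon.of_eqOn {p : Equiv.Perm (CantorCube S)} {φ : S → List Bool}
    (h : ∀ x ∈ brick φ, p x = x) : Canon p φ φ (1 : G) := fun κ => by
  rw [twist_one, h _ (brickMap_mem φ κ)]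

theorem Canon.apply_of_mem {p : Equiv.Perm (CantorCube S)} {φ : S → List Bool}
    (h : Canon p φ φ (1 : G)) {x : CantorCube S} (hx : x ∈ brick φ) : p x = x := by
  obtain ⟨κ, rfl⟩ := mem_brick_iff.1 hx
  rw [h, twist_one]

/-- `p` and `q` agree on a brick where both are canonical with the same data. -/
theorem Canon.apply_eq {p q : Equiv.Perm (CantorCube S)} {φ ψ : S → List Bool} {γ : G}
    (hp : Canon p φ ψ γ) (hq : Canon q φ ψ γ) {x : CantorCube S} (hx : x ∈ brick φ) :
    p x = q x := by
  obtain ⟨κ, rfl⟩ := mem_brick_iff.1 hx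
  rw [hp, hq]

/-- The permutation that acts on `B(φ)` as `g` does on the whole cube. -/
noncomputable def onBrick (φ : S → List Bool) :
    Equiv.Perm (CantorCube S) →* Equiv.Perm (CantorCube S) :=
  Equiv.Perm.viaEmbeddingHom ⟨brickMap φ, brickMap_injective φ⟩

theorem onBrick_apply (φ : S → List Bool) (g : Equiv.Perm (CantorCube S)) (κ : CantorCube S) :
    onBrick φ g (brickMap φ κ) = brickMap φ (g κ) :=
  Equiv.Perm.viaEmbedding_apply g ⟨brickMap φ, brickMap_injective φ⟩ κ

theorem onBrick_apply_of_notMem (φ : S → List Bool) (g : Equiv.Perm (CantorCube S))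
    {x : CantorCube S} (hx : x ∉ brick φ) : onBrick φ g x = x :=
  Equiv.Perm.viaEmbedding_apply_of_notMem g ⟨brickMap φ, brickMap_injective φ⟩ x
    fun ⟨κ, hκ⟩ => hx (mem_brick_iff.2 ⟨κ, hκ⟩)

theorem Canon.onBrick {g : Equiv.Perm (CantorCube S)} {α β : S → List Bool} {γ : G}
    (hg : Canon g α β γ) (φ : S → List Bool) :
    Canon (onBrick φ g) (TwistedBrinThompson.cat φ α) (TwistedBrinThompson.cat φ β) γ :=
  fun κ => by
  rw [brickMap_cat, onBrick_apply, hg, brickMap_cat]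

theorem Canon.onBrick_of_disjoint (g : Equiv.Perm (CantorCube S)) {φ χ : S → List Bool}
    (h : Disjoint (brick χ) (brick φ)) : Canon (TwistedBrinThompson.onBrick φ g) χ χ (1 : G) :=
  .of_eqOn fun _ hx => onBrick_apply_of_notMem φ g (Set.disjoint_left.1 h hx)

theorem onBrick_cat (φ ψ : S → List Bool) (g : Equiv.Perm (CantorCube S)) :
    onBrick (cat φ ψ) g = onBrick φ (onBrick ψ g) := by
  ext1 x
  by_cases hx : x ∈ brick φ
  · obtain ⟨κ, rfl⟩ := mem_brick_iff.1 hx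
    rw [onBrick_apply]
    by_cases hκ : κ ∈ brick ψ
    · obtain ⟨μ, rfl⟩ := mem_brick_iff.1 hκ
      rw [onBrick_apply, ← brickMap_cat, onBrick_apply, brickMap_cat]
    · rw [onBrick_apply_of_notMem ψ g hκ, onBrick_apply_of_notMem]
      intro h
      obtain ⟨μ, hμ⟩ := mem_brick_iff.1 h
      rw [brickMap_cat] at hμ
      exact hκ (brickMap_injective φ hμ ▸ brickMap_mem ψ μ)
  · rw [onBrick_apply_of_notMem φ _ hx, onBrick_apply_of_notMem]
    exact fun h => hx (brick_cat_subset φ ψ h)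

theorem onBrick_conj {c : Equiv.Perm (CantorCube S)} {φ ψ : S → List Bool}
    (hc : Canon c φ ψ (1 : G)) (g : Equiv.Perm (CantorCube S)) :
    c * onBrick φ g * c⁻¹ = onBrick ψ g := by
  rw [mul_inv_eq_iff_eq_mul]
  ext1 x
  simp only [Equiv.Perm.mul_apply]
  by_cases hx : x ∈ brick φ
  · obtain ⟨κ, rfl⟩ := mem_brick_iff.1 hx
    rw [onBrick_apply, hc, hc, onBrick_apply, twist_one, twist_one]
  · rw [onBrick_apply_of_notMem φ g hx, onBrick_apply_of_notMem ψ g]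
    rwa [hc.apply_mem_iff]

/-- The permutation `τ_γ`. -/
def twistPerm (γ : G) : Equiv.Perm (CantorCube S) where
  toFun := twist γ
  invFun := twist γ⁻¹
  left_inv κ := by rw [← twist_mul, inv_mul_cancel, twist_one]
  right_inv κ := by rw [← twist_mul, mul_inv_cancel, twist_one]

theorem Canon.twistPerm (γ : G) : Canon (twistPerm γ) (root : S → List Bool) root γ :=
  fun _ => rfl

/-- The two bricks to be exchanged, parametrized compatibly. -/
def swapEmbedding (φ ψ : S → List Bool) (γ : G) (h : Disjoint (brick φ) (brick ψ)) :
    CantorCube S ⊕ CantorCube S ↪ CantorCube S where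
  toFun := Sum.elim (brickMap φ) fun κ => brickMap ψ (twist γ κ)
  inj' := by
    refine (brickMap_injective φ).sumElim
      ((brickMap_injective ψ).comp (twistPerm γ).injective) fun κ μ e => ?_
    exact Set.disjoint_left.1 h (brickMap_mem φ κ) (e ▸ brickMap_mem ψ _)

/-- The involution that exchanges `B(φ)` and `B(ψ)` by the canonical twist homeomorphism of
`γ`. -/
noncomputable def swap (φ ψ : S → List Bool) (γ : G) (h : Disjoint (brick φ) (brick ψ)) :
    Equiv.Perm (CantorCube S) :=
  Equiv.Perm.viaEmbedding (Equiv.sumComm _ _) (swapEmbedding φ ψ γ h)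

variable {φ ψ : S → List Bool}

theorem swap_left (γ : G) (h : Disjoint (brick φ) (brick ψ)) :
    Canon (swap φ ψ γ h) φ ψ γ := fun κ =>
  Equiv.Perm.viaEmbedding_apply (Equiv.sumComm _ _) (swapEmbedding φ ψ γ h) (.inl κ)

theorem swap_right (γ : G) (h : Disjoint (brick φ) (brick ψ)) :
    Canon (swap φ ψ γ h) ψ φ γ⁻¹ := fun κ => by
  have := Equiv.Perm.viaEmbedding_apply (Equiv.sumComm _ _) (swapEmbedding φ ψ γ h)
    (.inr (twist γ⁻¹ κ))
  simpa [swapEmbedding, ← twist_mul, twist_one, swap] using this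

theorem swap_one_left (h : Disjoint (brick φ) (brick ψ)) :
    Canon (swap φ ψ (1 : G) h) φ ψ (1 : G) := swap_left 1 h

theorem swap_one_right (h : Disjoint (brick φ) (brick ψ)) :
    Canon (swap φ ψ (1 : G) h) ψ φ (1 : G) := by
  simpa using swap_right (1 : G) h

theorem swap_apply_of_notMem (γ : G) (h : Disjoint (brick φ) (brick ψ)) {x : CantorCube S}
    (h1 : x ∉ brick φ) (h2 : x ∉ brick ψ) : swap φ ψ γ h x = x := by
  refine Equiv.Perm.viaEmbedding_apply_of_notMem _ _ _ ?_
  rintro ⟨κ | κ, rfl⟩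
  · exact h1 (brickMap_mem φ κ)
  · exact h2 (brickMap_mem ψ _)

theorem swap_of_disjoint (γ : G) (h : Disjoint (brick φ) (brick ψ)) {χ : S → List Bool}
    (h1 : Disjoint (brick χ) (brick φ)) (h2 : Disjoint (brick χ) (brick ψ)) :
    Canon (swap φ ψ γ h) χ χ (1 : G) :=
  .of_eqOn fun _ hx =>
    swap_apply_of_notMem γ h (Set.disjoint_left.1 h1 hx) (Set.disjoint_left.1 h2 hx)

/-- Since `c` is untwisted on both bricks, the label `γ` survives conjugation. This is what lets one
exchange produce all others with the same `γ`. -/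
theorem swap_conj {c : Equiv.Perm (CantorCube S)} {φ' ψ' : S → List Bool} (γ : G)
    (h : Disjoint (brick φ) (brick ψ)) (h' : Disjoint (brick φ') (brick ψ'))
    (hφ : Canon c φ φ' (1 : G)) (hψ : Canon c ψ ψ' (1 : G)) :
    c * swap φ ψ γ h * c⁻¹ = swap φ' ψ' γ h' := by
  rw [mul_inv_eq_iff_eq_mul]
  ext1 x
  by_cases h1 : x ∈ brick φ
  · exact Canon.apply_eq (by simpa using (swap_left γ h).comp hψ)
      (by simpa using hφ.comp (swap_left γ h')) h1
  by_cases h2 : x ∈ brick ψ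
  · exact Canon.apply_eq (by simpa using (swap_right γ h).comp hφ)
      (by simpa using hψ.comp (swap_right γ h')) h2
  simp only [Equiv.Perm.mul_apply]
  rw [swap_apply_of_notMem γ h h1 h2, swap_apply_of_notMem]
  · rwa [hφ.apply_mem_iff]
  · rwa [hψ.apply_mem_iff]

/-- The twist by `γ` moves coordinate `s` to `γ • s`, so halving $B(\varphi)$ along `s` corresponds
to halving $B(\psi)$ along `γ • s`. -/
theorem swap_eq_mul (γ : G) (s : S) (h : Disjoint (brick φ) (brick ψ)) :
    swap φ ψ γ h =
      swap (cat φ (single s [false])) (cat ψ (single (γ • s) [false])) γ (disjoint_cat h _ _) *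
      swap (cat φ (single s [true])) (cat ψ (single (γ • s) [true])) γ (disjoint_cat h _ _) := by
  ext1 x
  by_cases h1 : x ∈ brick φ
  · obtain ⟨b, κ, rfl⟩ := exists_brickMap_cut s h1
    refine Canon.apply_eq ((swap_left γ h).cut s [b]) ?_ (brickMap_mem _ _)
    cases b
    · rw [← mul_one γ]
      exact (swap_of_disjoint _ _ (disjoint_cut φ s (by simp)) (disjoint_cat h _ _)).comp
        (by simpa using swap_left γ (disjoint_cat h _ _))
    · rw [← one_mul γ]
      exact Canon.comp (by simpa using swap_left γ (disjoint_cat h _ _))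
        (swap_of_disjoint _ _ (disjoint_cat h.symm _ _) (disjoint_cut ψ _ (by simp)))
  by_cases h2 : x ∈ brick ψ
  · obtain ⟨b, κ, rfl⟩ := exists_brickMap_cut (γ • s) h2
    refine Canon.apply_eq (γ := γ⁻¹)
      (by simpa using (swap_right γ h).cut (γ • s) [b]) ?_ (brickMap_mem _ _)
    cases b
    · rw [← mul_one γ⁻¹]
      exact (swap_of_disjoint _ _ (disjoint_cat h.symm _ _) (disjoint_cut ψ _ (by simp))).comp
        (swap_right γ (disjoint_cat h _ _))
    · rw [← one_mul γ⁻¹]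
      exact (swap_right γ (disjoint_cat h _ _)).comp
        (swap_of_disjoint _ _ (disjoint_cut φ s (by simp)) (disjoint_cat h _ _))
  have h1' := fun b h' => h1 (brick_cat_subset φ (single s [b]) h')
  have h2' := fun b h' => h2 (brick_cat_subset ψ (single (γ • s) [b]) h')
  rw [swap_apply_of_notMem γ h h1 h2, Equiv.Perm.mul_apply,
    swap_apply_of_notMem γ _ (h1' true) (h2' true),
    swap_apply_of_notMem γ _ (h1' false) (h2' false)]

theorem onBrick_swap (χ : S → List Bool) (γ : G) (h : Disjoint (brick φ) (brick ψ)) :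
    onBrick χ (swap φ ψ γ h) = swap (cat χ φ) (cat χ ψ) γ (disjoint_cat_cat χ h) := by
  ext1 x
  by_cases hx : x ∈ brick χ
  · obtain ⟨κ, rfl⟩ := mem_brick_iff.1 hx
    by_cases h1 : κ ∈ brick φ
    · obtain ⟨μ, rfl⟩ := mem_brick_iff.1 h1
      rw [onBrick_apply, ← brickMap_cat, swap_left, swap_left, brickMap_cat]
    by_cases h2 : κ ∈ brick ψ
    · obtain ⟨μ, rfl⟩ := mem_brick_iff.1 h2
      rw [onBrick_apply, ← brickMap_cat, swap_right, swap_right, brickMap_cat]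
    rw [onBrick_apply, swap_apply_of_notMem γ h h1 h2, swap_apply_of_notMem]
    all_goals
      intro h'
      obtain ⟨μ, hμ⟩ := mem_brick_iff.1 h'
      rw [brickMap_cat] at hμ
      rw [← brickMap_injective χ hμ] at h1 h2
      first | exact h1 (brickMap_mem _ _) | exact h2 (brickMap_mem _ _)
  · rw [onBrick_apply_of_notMem χ _ hx, swap_apply_of_notMem]
    all_goals exact fun h => hx (brick_cat_subset _ _ h)

end Canonical

end TwistedBrinThompson

namespace TwistedBrinThompson

/-! ### Refining partitions by successive halving. -/

section Refinement

variable {S : Type v}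

/-- The list `m` of bricks arises from `l` by repeatedly halving a brick along some coordinate,
and by reordering. -/
inductive Cut (l : List (S → List Bool)) : List (S → List Bool) → Prop
  | refl : Cut l l
  | cut {φ : S → List Bool} {r : List (S → List Bool)} (t : S) : Cut l (φ :: r) →
      Cut l (cat φ (single t [false]) :: cat φ (single t [true]) :: r)
  | perm {m m' : List (S → List Bool)} : Cut l m → m.Perm m' → Cut l m'

theorem Cut.trans {l m n : List (S → List Bool)} (h : Cut l m) (h' : Cut m n) : Cut l n := by
  induction h' with
  | refl => exact h
  | cut t _ ih => exact ih.cut t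
  | perm _ hp ih => exact ih.perm hp

theorem Cut.append_right {l m : List (S → List Bool)} (h : Cut l m) (r : List (S → List Bool)) :
    Cut (l ++ r) (m ++ r) := by
  induction h with
  | refl => exact .refl
  | cut t _ ih => exact ih.cut t
  | perm _ hp ih => exact ih.perm (hp.append_right r)

theorem Cut.append_left {l m : List (S → List Bool)} (h : Cut l m) (r : List (S → List Bool)) :
    Cut (r ++ l) (r ++ m) :=
  (Cut.refl.perm List.perm_append_comm).trans
    ((h.append_right r).perm List.perm_append_comm)

/-- Finitely supported functions whose bricks are pairwise disjoint. -/
structure IsDisjointList (l : List (S → List Bool)) : Prop where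
  finiteSupport : ∀ φ ∈ l, FiniteSupport φ
  disjoint : l.Pairwise fun φ ψ => Disjoint (brick φ) (brick ψ)

/-- The bricks in the list cover the cube. -/
def Covers (l : List (S → List Bool)) : Prop := ∀ x, ∃ φ ∈ l, x ∈ brick φ

theorem IsDisjointList.perm {l m : List (S → List Bool)} (hl : IsDisjointList l)
    (h : l.Perm m) : IsDisjointList m :=
  ⟨fun φ hφ => hl.finiteSupport φ (h.mem_iff.2 hφ),
    (h.pairwise_iff fun h => Disjoint.symm h).1 hl.disjoint⟩

theorem IsDisjointList.of_cons {φ : S → List Bool} {l : List (S → List Bool)}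
    (h : IsDisjointList (φ :: l)) : IsDisjointList l :=
  ⟨fun ψ hψ => h.finiteSupport ψ (List.mem_cons_of_mem _ hψ), h.disjoint.of_cons⟩

theorem IsDisjointList.disjoint_head {φ ψ : S → List Bool} {l : List (S → List Bool)}
    (h : IsDisjointList (φ :: l)) (hψ : ψ ∈ l) : Disjoint (brick φ) (brick ψ) :=
  List.rel_of_pairwise_cons h.disjoint hψ

theorem IsDisjointList.cut {l m : List (S → List Bool)} (hl : IsDisjointList l) (h : Cut l m) :
    IsDisjointList m := by
  induction h with
  | refl => exact hl
  | @cut φ r t _ ih =>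
    refine ⟨?_, ?_⟩
    · have := ih.finiteSupport
      simp only [List.forall_mem_cons] at this ⊢
      exact ⟨this.1.cut _ _, this.1.cut _ _, this.2⟩
    · refine .cons ?_ (.cons ?_ ih.disjoint.of_cons)
      · simp only [List.forall_mem_cons]
        exact ⟨disjoint_cut _ _ (by simp), fun ψ hψ => disjoint_cat_left (ih.disjoint_head hψ) _⟩
      · exact fun ψ hψ => disjoint_cat_left (ih.disjoint_head hψ) _
  | perm _ hp ih => exact ih.perm hp

theorem Covers.cut {l m : List (S → List Bool)} (hl : Covers l) (h : Cut l m) : Covers m := by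
  induction h with
  | refl => exact hl
  | @cut φ r t _ ih =>
    intro x
    obtain ⟨ψ, hψ, hx⟩ := ih x
    rcases List.mem_cons.1 hψ with rfl | hψ
    · obtain ⟨b, μ, rfl⟩ := exists_brickMap_cut t hx
      refine ⟨_, ?_, brickMap_mem _ _⟩
      cases b <;> simp
    · exact ⟨ψ, by simp [hψ], hx⟩
  | perm _ hp ih => exact fun x => (ih x).imp fun ψ h => ⟨hp.mem_iff.1 h.1, h.2⟩

theorem isDisjointList_root : IsDisjointList [(root : S → List Bool)] :=
  ⟨fun φ hφ => by rw [List.mem_singleton.1 hφ]; exact .root, List.pairwise_singleton _ _⟩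

theorem covers_root : Covers [(root : S → List Bool)] := fun x =>
  ⟨root, by simp, brick_root ▸ Set.mem_univ x⟩

/-- Words of length at most `N` on `F`, and empty words elsewhere. -/
def Bounded (F : Finset S) (N : ℕ) (φ : S → List Bool) : Prop :=
  ∀ s, (φ s).length ≤ N ∧ (s ∉ F → φ s = [])

/-- Words of length `N` on `F`, and empty words elsewhere. -/
def grid (F : Finset S) (N : ℕ) : Set (S → List Bool) :=
  {w | ∀ s, (s ∈ F → (w s).length = N) ∧ (s ∉ F → w s = [])}

theorem FiniteSupport.exists_bounded {l : List (S → List Bool)} (h : ∀ φ ∈ l, FiniteSupport φ) :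
    ∃ F N, ∀ φ ∈ l, Bounded F N φ := by
  classical
  induction l with
  | nil => exact ⟨∅, 0, by simp⟩
  | cons φ l ih =>
    obtain ⟨F, N, hF⟩ := ih fun ψ hψ => h ψ (List.mem_cons_of_mem _ hψ)
    have hφ : FiniteSupport φ := h φ List.mem_cons_self
    have hfin : {s | φ s ≠ []}.Finite := hφ
    have hmem : ∀ s, s ∉ hfin.toFinset → φ s = [] := fun s hs => by simpa using hs
    refine ⟨F ∪ hfin.toFinset, max N (hfin.toFinset.sup fun s => (φ s).length), ?_⟩
    intro ψ hψ s
    rcases List.mem_cons.1 hψ with rfl | hψ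
    · refine ⟨?_, fun hs => hmem s fun h => hs (Finset.mem_union_right _ h)⟩
      by_cases hs : s ∈ hfin.toFinset
      · exact le_max_of_le_right (Finset.le_sup (f := fun s => (ψ s).length) hs)
      · simp [hmem s hs]
    · exact ⟨le_max_of_le_left (hF ψ hψ s).1,
        fun hs => (hF ψ hψ s).2 fun h => hs (Finset.mem_union_left _ h)⟩

/-- Halving continues until all words on `F` have length `N`. Describing the result by its members,
without repetition, makes it unique up to order, so that refinements of different partitions can be
compared. -/
theorem exists_cut_grid_singleton {F : Finset S} {N : ℕ} (φ : S → List Bool)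
    (hφ : Bounded F N φ) : ∃ T, Cut [φ] T ∧ T.Nodup ∧
      ∀ w, w ∈ T ↔ w ∈ grid F N ∧ ∀ s, φ s <+: w s := by
  classical
  -- The measure is the number of letters still missing; halving along `t` lowers it by one.
  induction hk : ∑ s ∈ F, (N - (φ s).length) using Nat.strong_induction_on generalizing φ with
  | _ k ih =>
  by_cases h : ∃ t ∈ F, (φ t).length < N
  · obtain ⟨t, ht, hlt⟩ := h
    have hcut : ∀ b s, (cat φ (single t [b]) s).length =
        (φ s).length + if s = t then 1 else 0 := by
      intro b s
      simp only [cat, single, List.length_append]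
      split_ifs <;> rfl
    have hb : ∀ b, Bounded F N (cat φ (single t [b])) := by
      intro b s
      constructor
      · rw [hcut]
        split_ifs with hs
        · subst hs; omega
        · exact (hφ s).1
      · intro hs
        have : s ≠ t := fun e => hs (e ▸ ht)
        simp [cat, single, this, (hφ s).2 hs]
    have hsum : ∀ b, ∑ s ∈ F, (N - (cat φ (single t [b]) s).length) < k := by
      intro b
      rw [← hk]
      refine Finset.sum_lt_sum (fun s _ => ?_) ⟨t, ht, ?_⟩
      · rw [hcut]; omega
      · rw [hcut, if_pos rfl]; omega
    obtain ⟨T, hT1, hT2, hT3⟩ := ih _ (hsum false) _ (hb false) rfl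
    obtain ⟨U, hU1, hU2, hU3⟩ := ih _ (hsum true) _ (hb true) rfl
    refine ⟨T ++ U, ((Cut.refl.cut t).trans ((hU1.append_left [_]))).trans (hT1.append_right U),
      List.nodup_append.2 ⟨hT2, hU2, ?_⟩, fun w => ?_⟩
    · rintro a ha _ hb' rfl
      have h1 := ((hT3 a).1 ha).2 t
      have h2 := ((hU3 a).1 hb').2 t
      have := (List.prefix_of_prefix_length_le h1 h2 (by simp [hcut])).eq_of_length
        (by simp [hcut])
      simp [cat, single] at this
    · rw [List.mem_append, hT3, hU3, ← and_or_left]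
      refine and_congr_right fun hw => ⟨?_, fun hp => ?_⟩
      · rintro (h | h) <;> exact fun s => (List.prefix_append _ _).trans (h s)
      · obtain ⟨a, rfl⟩ := exists_eq_cat hp
        have hat : (a t) ≠ [] := by
          intro h
          have := (hw t).1 ht
          simp only [cat, h, List.append_nil] at this
          omega
        obtain ⟨b, r, hbr⟩ := List.exists_cons_of_ne_nil hat
        have key : ∀ s, cat φ (single t [b]) s <+: cat φ a s := by
          intro s
          refine (List.prefix_append_right_inj _).2 ?_
          by_cases hs : s = t
          · subst hs
            simp [single, hbr]
          · simp [single, hs]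
        cases b
        · exact .inl key
        · exact .inr key
  · push Not at h
    have hφN : ∀ s ∈ F, (φ s).length = N := fun s hs => le_antisymm (hφ s).1 (h s hs)
    refine ⟨[φ], .refl, List.nodup_singleton _, fun w => ?_⟩
    rw [List.mem_singleton]
    constructor
    · rintro rfl
      exact ⟨fun s => ⟨hφN s, (hφ s).2⟩, fun s => List.prefix_rfl⟩
    · rintro ⟨hw, hp⟩
      funext s
      refine ((hp s).eq_of_length ?_).symm
      by_cases hs : s ∈ F
      · rw [hφN s hs, (hw s).1 hs]
      · rw [(hφ s).2 hs, (hw s).2 hs]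

theorem brick_subset_of_prefix {φ w : S → List Bool} (h : ∀ s, φ s <+: w s) :
    brick w ⊆ brick φ := by
  obtain ⟨a, rfl⟩ := exists_eq_cat h
  exact brick_cat_subset φ a

theorem exists_cut_grid {F : Finset S} {N : ℕ} {l : List (S → List Bool)}
    (hl : IsDisjointList l) (hb : ∀ φ ∈ l, Bounded F N φ) : ∃ T, Cut l T ∧ T.Nodup ∧
      ∀ w, w ∈ T ↔ w ∈ grid F N ∧ ∃ φ ∈ l, ∀ s, φ s <+: w s := by
  induction l with
  | nil => exact ⟨[], .refl, List.nodup_nil, by simp⟩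
  | cons φ l ih =>
    obtain ⟨T, hT1, hT2, hT3⟩ := ih hl.of_cons fun ψ hψ => hb ψ (List.mem_cons_of_mem _ hψ)
    obtain ⟨U, hU1, hU2, hU3⟩ := exists_cut_grid_singleton φ (hb φ List.mem_cons_self)
    refine ⟨U ++ T, (hU1.append_right l).trans (hT1.append_left U),
      List.nodup_append.2 ⟨hU2, hT2, ?_⟩, fun w => ?_⟩
    · rintro a ha _ hb' rfl
      obtain ⟨-, ψ, hψ, h2⟩ := (hT3 a).1 hb'
      exact not_disjoint_self a ((hl.disjoint_head hψ).mono
        (brick_subset_of_prefix ((hU3 a).1 ha).2) (brick_subset_of_prefix h2))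
    · rw [List.mem_append, hT3, hU3, ← and_or_left]
      simp

theorem prefix_of_mem_grid {F : Finset S} {N : ℕ} {φ w : S → List Bool} (hφ : Bounded F N φ)
    (hw : w ∈ grid F N) {x : CantorCube S} (hx : x ∈ brick φ) (hxw : x ∈ brick w) (s : S) :
    φ s <+: w s := by
  refine isPrefix_of_mem (hx s) (hxw s) ?_
  by_cases hs : s ∈ F
  · rw [(hw s).1 hs]; exact (hφ s).1
  · rw [(hφ s).2 hs]; exact Nat.zero_le _

theorem bounded_root (F : Finset S) (N : ℕ) : Bounded F N root :=
  fun _ => ⟨Nat.zero_le _, fun _ => rfl⟩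

/-- Any partition into bricks can be refined to one that arises from the whole cube by repeated
halving. -/
theorem exists_cut_of_covers {l : List (S → List Bool)} (hl : IsDisjointList l)
    (hc : Covers l) : ∃ T, Cut [root] T ∧ Cut l T := by
  obtain ⟨F, N, hF⟩ := FiniteSupport.exists_bounded hl.finiteSupport
  obtain ⟨T, hT1, hT2, hT3⟩ := exists_cut_grid hl hF
  obtain ⟨U, hU1, hU2, hU3⟩ := exists_cut_grid_singleton (F := F) (N := N) root (bounded_root F N)
  -- The partition and the whole cube have the same grid refinement: a grid brick meets some brick
  -- of the cover, and its words are long enough that it then lies inside. The detour is needed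
  -- because, with three or more coordinates, a partition need not itself arise by halving.
  refine ⟨U, hU1, hT1.perm ((List.perm_ext_iff_of_nodup hT2 hU2).2 fun w => ?_)⟩
  rw [hT3, hU3]
  refine and_congr_right fun hw => ⟨fun _ s => List.nil_prefix, fun _ => ?_⟩
  obtain ⟨x, hx⟩ := brick_nonempty w
  obtain ⟨φ, hφ, hxφ⟩ := hc x
  exact ⟨φ, hφ, prefix_of_mem_grid (hF φ hφ) hw hxφ hx⟩

/-- Any finite cover by bricks can be refined to a partition. -/
theorem exists_partition_of_covers {l : List (S → List Bool)} (hl : ∀ φ ∈ l, FiniteSupport φ)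
    (hc : Covers l) : ∃ T, IsDisjointList T ∧ Covers T ∧ ∀ w ∈ T, ∃ φ ∈ l, ∃ a, w = cat φ a := by
  obtain ⟨F, N, hF⟩ := FiniteSupport.exists_bounded hl
  obtain ⟨U, hU1, -, hU3⟩ := exists_cut_grid_singleton (F := F) (N := N) root (bounded_root F N)
  refine ⟨U, isDisjointList_root.cut hU1, covers_root.cut hU1, fun w hw => ?_⟩
  obtain ⟨x, hx⟩ := brick_nonempty w
  obtain ⟨φ, hφ, hxφ⟩ := hc x
  exact ⟨φ, hφ, exists_eq_cat (prefix_of_mem_grid (hF φ hφ) ((hU3 w).1 hw).1 hxφ hx)⟩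

end Refinement

/-! ### A local criterion for membership in the group. -/

section Membership

variable {G : Type u} {S : Type v} [Group G] [MulAction G S]

theorem isOpen_brick {φ : S → List Bool} (hφ : FiniteSupport φ) : IsOpen (brick φ) := by
  have : brick φ = ⋂ s ∈ {s | φ s ≠ []}, {κ : CantorCube S | IsPrefixOf (φ s) (κ s)} := by
    ext κ
    simp only [brick, Set.mem_ofPred_eq, Set.mem_iInter]
    refine ⟨fun h s _ => h s, fun h s => ?_⟩
    by_cases hs : φ s = []
    · rw [hs]
      exact fun n hn => absurd hn (Nat.not_lt_zero n)
    · exact h s hs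
  rw [this]
  refine Set.Finite.isOpen_biInter hφ fun s _ => ?_
  have : {κ : CantorCube S | IsPrefixOf (φ s) (κ s)} =
      ⋂ i : Fin (φ s).length, (fun κ : CantorCube S => κ s i) ⁻¹' {(φ s)[i]} := by
    ext κ
    simp [IsPrefixOf, Fin.forall_iff]
  rw [this]
  exact isOpen_iInter_of_finite fun i =>
    (isOpen_discrete _).preimage ((continuous_apply _).comp (continuous_apply s))

theorem continuous_brickMap (ψ : S → List Bool) : Continuous (brickMap ψ) := by
  refine continuous_pi fun s => continuous_pi fun n => ?_
  simp only [brickMap, prepend]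
  split_ifs
  · exact continuous_const
  · exact (continuous_apply _).comp (continuous_apply s)

theorem continuous_twist (γ : G) : Continuous (twist γ : CantorCube S → CantorCube S) :=
  continuous_pi fun _ => continuous_apply _

/-- Removal of the words `φ`, a left inverse of `brickMap φ`. -/
def strip (φ : S → List Bool) (κ : CantorCube S) : CantorCube S :=
  fun s n => κ s (n + (φ s).length)

theorem strip_brickMap (φ : S → List Bool) (κ : CantorCube S) : strip φ (brickMap φ κ) = κ := by
  funext s n
  simp [strip, brickMap, prepend]

theorem continuous_strip (φ : S → List Bool) : Continuous (strip φ) :=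
  continuous_pi fun s => continuous_pi fun _ => (continuous_apply _).comp (continuous_apply s)

variable (G) in
/-- Around each point, `p` is a canonical twist homeomorphism between bricks. -/
def IsLocallyCanon (p : Equiv.Perm (CantorCube S)) : Prop :=
  ∀ x, ∃ (φ ψ : S → List Bool) (γ : G), FiniteSupport φ ∧ FiniteSupport ψ ∧ x ∈ brick φ ∧
    Canon p φ ψ γ

theorem IsLocallyCanon.continuous {p : Equiv.Perm (CantorCube S)} (hp : IsLocallyCanon G p) :
    Continuous p := by
  refine continuous_iff_continuousAt.2 fun x => ?_
  obtain ⟨φ, ψ, γ, hφ, -, hx, h⟩ := hp x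
  have : Continuous fun y => brickMap ψ (twist γ (strip φ y)) :=
    (continuous_brickMap ψ).comp ((continuous_twist γ).comp (continuous_strip φ))
  refine this.continuousAt.congr ?_
  filter_upwards [(isOpen_brick hφ).mem_nhds hx] with y hy
  obtain ⟨κ, rfl⟩ := mem_brick_iff.1 hy
  rw [strip_brickMap, h]

/-- Homeomorphisms as permutations. -/
def toPerm (X : Type v) [TopologicalSpace X] : (X ≃ₜ X) →* Equiv.Perm X :=
  MonoidHom.mk' Homeomorph.toEquiv fun _ _ => rfl

variable (G S) in
/-- The twisted Brin–Thompson group as a group of permutations. -/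
def permGroup : Subgroup (Equiv.Perm (CantorCube S)) :=
  (twistedBrinThompsonGroup G S).map (toPerm (CantorCube S))

theorem isBrickPartition_get {l : List (S → List Bool)} (hl : IsDisjointList l) (hc : Covers l) :
    IsBrickPartition fun i : Fin l.length => l.get i where
  finiteSupport i := hl.finiteSupport _ (List.get_mem l i)
  disjoint i j hij := by
    rcases lt_or_gt_of_ne hij with h | h
    · exact List.pairwise_iff_get.1 hl.disjoint i j h
    · exact (List.pairwise_iff_get.1 hl.disjoint j i h).symm
  cover := by
    refine Set.eq_univ_of_forall fun x => ?_
    obtain ⟨φ, hφ, hx⟩ := hc x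
    obtain ⟨i, rfl⟩ := List.get_of_mem hφ
    exact Set.mem_iUnion.2 ⟨i, hx⟩

/-- Compactness of the cube leaves finitely many of the local bricks, and these refine to a
partition. The criterion makes it unnecessary to exhibit partitions, or to check continuity, for the
individual elements constructed below. -/
theorem IsLocallyCanon.mem_permGroup {p : Equiv.Perm (CantorCube S)}
    (hp : IsLocallyCanon G p) : p ∈ permGroup G S := by
  choose φ ψ γ hφ hψ hx hcan using hp
  obtain ⟨t, ht⟩ := isCompact_univ.elim_finite_subcover (fun x => brick (φ x))
    (fun x => isOpen_brick (hφ x)) fun x _ => Set.mem_iUnion.2 ⟨x, hx x⟩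
  obtain ⟨T, hT, hTc, hTr⟩ := exists_partition_of_covers (l := t.toList.map φ)
    (by simp only [List.mem_map]; rintro _ ⟨x, -, rfl⟩; exact hφ x)
    (by
      intro x
      obtain ⟨y, hy, hxy⟩ := Set.mem_iUnion₂.1 (ht (Set.mem_univ x))
      exact ⟨φ y, List.mem_map.2 ⟨y, Finset.mem_toList.2 hy, rfl⟩, hxy⟩)
  have key : ∀ i : Fin T.length, ∃ (ψ' : S → List Bool) (γ' : G), FiniteSupport ψ' ∧
      Canon p (T.get i) ψ' γ' := by
    intro i
    obtain ⟨_, hw, a, ha⟩ := hTr _ (List.get_mem T i)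
    obtain ⟨y, -, rfl⟩ := List.mem_map.1 hw
    have hfin := hT.finiteSupport _ (List.get_mem T i)
    rw [ha] at hfin ⊢
    exact ⟨_, _, (hψ y).cat (hfin.of_cat.smul _), (hcan y).cat a⟩
  choose ψ' γ' hψ' hcan' using key
  have hdom := isBrickPartition_get hT hTc
  have hcont : Continuous p := IsLocallyCanon.continuous (G := G)
    fun x => ⟨φ x, ψ x, γ x, hφ x, hψ x, hx x, hcan x⟩
  refine ⟨hcont.homeoOfEquivCompactToT2, ⟨T.length, _, ψ', γ', hdom, ?_, hcan'⟩, Equiv.ext fun _ => rfl⟩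
  -- The image bricks form a partition because `p` is a bijection carrying the domain partition onto
  -- them.
  exact hdom.comap hψ' p.symm fun i => brick_eq_preimage p.symm.injective (hcan' i).inv

theorem mem_permGroup_iff {p : Equiv.Perm (CantorCube S)} :
    p ∈ permGroup G S ↔ ∃ (n : ℕ) (φ ψ : Fin n → S → List Bool) (γ : Fin n → G),
      IsPiecewiseTwist φ ψ γ p := by
  constructor
  · rintro ⟨f, hf, rfl⟩
    exact hf
  · rintro ⟨n, φ, ψ, γ, h⟩
    refine IsLocallyCanon.mem_permGroup (G := G) fun x => ?_
    obtain ⟨i, hi⟩ := Set.mem_iUnion.1 (h.domain.cover ▸ Set.mem_univ x)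
    exact ⟨_, _, γ i, h.domain.finiteSupport i, h.image.finiteSupport i, hi, h.map_brick i⟩

theorem isLocallyCanon_of_mem {p : Equiv.Perm (CantorCube S)} (hp : p ∈ permGroup G S) :
    IsLocallyCanon G p := by
  obtain ⟨n, φ, ψ, γ, h⟩ := mem_permGroup_iff.1 hp
  intro x
  obtain ⟨i, hi⟩ := Set.mem_iUnion.1 (h.domain.cover ▸ Set.mem_univ x)
  exact ⟨_, _, γ i, h.domain.finiteSupport i, h.image.finiteSupport i, hi, h.map_brick i⟩

end Membership

end TwistedBrinThompson

namespace TwistedBrinThompson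

/-! ### Exchanges, brick copies, twists and baker's maps as elements of the group. -/

section Elements

variable {G : Type u} {S : Type v} [Group G] [MulAction G S] {φ ψ : S → List Bool}

theorem exists_disjoint_brick (hφ : FiniteSupport φ) {x : CantorCube S} (hx : x ∉ brick φ) :
    ∃ χ, FiniteSupport χ ∧ x ∈ brick χ ∧ Disjoint (brick χ) (brick φ) := by
  -- Reading from `x` as many letters as `φ` prescribes decides membership in $B(\varphi)$.
  refine ⟨fun s => List.ofFn fun i : Fin (φ s).length => x s i, ?_, ?_, ?_⟩
  · refine Set.Finite.subset hφ fun s hs h => hs ?_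
    simp [h]
  · intro s n hn
    simp
  · refine Set.disjoint_left.2 fun y h1 h2 => hx fun s n hn => ?_
    have := h1 s n (by simpa using hn)
    rw [← h2 s n hn, this]
    simp

/-- A point outside both bricks has a brick neighbourhood avoiding them, on which `p` is the
identity; so only points of the two bricks need attention. -/
theorem IsLocallyCanon.of_support {p : Equiv.Perm (CantorCube S)} (hφ : FiniteSupport φ)
    (hψ : FiniteSupport ψ) (h : ∀ x, x ∉ brick φ → x ∉ brick ψ → p x = x)
    (h' : ∀ x, x ∈ brick φ ∨ x ∈ brick ψ → ∃ (α β : S → List Bool) (γ : G),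
      FiniteSupport α ∧ FiniteSupport β ∧ x ∈ brick α ∧ Canon p α β γ) :
    IsLocallyCanon G p := by
  intro x
  by_cases hx : x ∈ brick φ ∨ x ∈ brick ψ
  · exact h' x hx
  · rw [not_or] at hx
    obtain ⟨χ, h1, h2, h3⟩ := exists_disjoint_brick hφ hx.1
    obtain ⟨ω, h4, h5, h6⟩ := exists_disjoint_brick hψ hx.2
    have hb := brick_meet (ψ := χ) (φ := ω) ⟨x, h2, h5⟩
    have hf : FiniteSupport (meet χ ω) := h1.append (h4.drop _)
    refine ⟨meet χ ω, meet χ ω, 1, hf, hf, hb ▸ ⟨h2, h5⟩, .of_eqOn fun y hy => ?_⟩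
    rw [hb] at hy
    exact h y (Set.disjoint_left.1 h3 hy.1) (Set.disjoint_left.1 h6 hy.2)

theorem swap_mem_permGroup (hφ : FiniteSupport φ) (hψ : FiniteSupport ψ) (γ : G)
    (h : Disjoint (brick φ) (brick ψ)) : swap φ ψ γ h ∈ permGroup G S := by
  refine IsLocallyCanon.mem_permGroup (.of_support hφ hψ
    (fun x => swap_apply_of_notMem γ h) ?_)
  rintro x (hx | hx)
  · exact ⟨φ, ψ, γ, hφ, hψ, hx, swap_left γ h⟩
  · exact ⟨ψ, φ, γ⁻¹, hψ, hφ, hx, swap_right γ h⟩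

theorem onBrick_mem_permGroup (hφ : FiniteSupport φ) {g : Equiv.Perm (CantorCube S)}
    (hg : g ∈ permGroup G S) : onBrick φ g ∈ permGroup G S := by
  refine IsLocallyCanon.mem_permGroup (.of_support hφ hφ
    (fun x hx _ => onBrick_apply_of_notMem φ g hx) ?_)
  rintro x hx
  obtain ⟨κ, rfl⟩ := mem_brick_iff.1 (or_self_iff.1 hx)
  obtain ⟨α, β, γ, hα, hβ, hκ, h⟩ := isLocallyCanon_of_mem hg κ
  refine ⟨_, _, γ, hφ.cat hα, hφ.cat hβ, ?_, h.onBrick φ⟩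
  obtain ⟨μ, rfl⟩ := mem_brick_iff.1 hκ
  rw [← brickMap_cat]
  exact brickMap_mem _ _

theorem twistPerm_mem_permGroup (γ : G) : twistPerm γ ∈ permGroup G S :=
  IsLocallyCanon.mem_permGroup fun x =>
    ⟨root, root, γ, .root, .root, brick_root ▸ Set.mem_univ x, .twistPerm γ⟩

open Classical in
/-- The baker's map, which moves the first letter of the coordinate `s` to the coordinate `t`. -/
noncomputable def bakerMap (s t : S) (κ : CantorCube S) : CantorCube S := fun r =>
  if s = t then κ r else if r = s then fun n => κ s (n + 1)
  else if r = t then prepend [κ s 0] (κ t) else κ r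

theorem bakerMap_brickMap (s t : S) (b : Bool) (κ : CantorCube S) :
    bakerMap s t (brickMap (single s [b]) κ) = brickMap (single t [b]) κ := by
  funext r n
  by_cases hst : s = t
  · simp [bakerMap, hst]
  · by_cases hs : r = s
    · subst hs
      simp [bakerMap, hst, brickMap, single, prepend]
    · by_cases ht : r = t
      · subst ht
        simp [bakerMap, hst, brickMap, single, prepend, hs]
      · simp [bakerMap, hst, brickMap, single, prepend, hs, ht]

theorem bakerMap_bakerMap (s t : S) (κ : CantorCube S) : bakerMap t s (bakerMap s t κ) = κ := by
  obtain ⟨b, μ, rfl⟩ := exists_brickMap_single s κ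
  rw [bakerMap_brickMap, bakerMap_brickMap]

/-- The baker's map as a permutation. -/
noncomputable def baker (s t : S) : Equiv.Perm (CantorCube S) where
  toFun := bakerMap s t
  invFun := bakerMap t s
  left_inv := bakerMap_bakerMap s t
  right_inv := bakerMap_bakerMap t s

theorem Canon.baker (s t : S) (b : Bool) :
    Canon (baker s t) (single s [b]) (single t [b]) (1 : G) := fun κ => by
  rw [twist_one]
  exact bakerMap_brickMap s t b κ

theorem baker_self (s : S) : baker s s = 1 := by
  ext1 κ
  funext r
  exact if_pos rfl

variable (G) in
theorem baker_mem_permGroup (s t : S) : baker s t ∈ permGroup G S :=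
  IsLocallyCanon.mem_permGroup fun x => by
    obtain ⟨b, μ, rfl⟩ := exists_brickMap_single s x
    exact ⟨_, _, 1, .single s _, .single t _, brickMap_mem _ _, .baker s t b⟩

variable (G) in
-- On the brick where the word at `s` is $bc$, the copies inside the halves move $c$ to coordinate
-- `t`, whereas the baker's map moves $b$. The results differ by interchanging $b$ and $c$, which
-- matters only for $(b,c)=(0,1)$ and $(1,0)$: this is the exchange.
theorem baker_eq_mul {s t : S} (hst : s ≠ t)
    (h : Disjoint (brick (cat (single s [false]) (single t [true])))
      (brick (cat (single s [true]) (single t [false])))) :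
    baker s t = swap (cat (single s [false]) (single t [true]))
      (cat (single s [true]) (single t [false])) (1 : G) h *
      (onBrick (single s [false]) (baker s t) * onBrick (single s [true]) (baker s t)) := by
  ext1 x
  obtain ⟨b, κ, rfl⟩ := exists_brickMap_single s x
  obtain ⟨c, μ, rfl⟩ := exists_brickMap_single s κ
  rw [← brickMap_cat]
  refine Canon.apply_eq (G := G) ((Canon.baker s t b).cut_one s [c]) ?_ (brickMap_mem _ _)
  have h1 : Canon (onBrick (single s [false]) (baker s t) *
      onBrick (single s [true]) (baker s t)) (cat (single s [b]) (single s [c]))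
      (cat (single s [b]) (single t [c])) (1 : G) := by
    cases b
    · exact (Canon.onBrick_of_disjoint _ (disjoint_cat_left (disjoint_single s (by simp)) _)).comp_one
        ((Canon.baker s t c).onBrick _)
    · exact ((Canon.baker s t c).onBrick _).comp_one
        (Canon.onBrick_of_disjoint _ (disjoint_cat_left (disjoint_single s (by simp)) _))
  refine h1.comp_one ?_
  rw [single_cat_comm hst.symm [b] [c]]
  have hd : ∀ {b c b' c' : Bool}, (b, c) ≠ (b', c') →
      Disjoint (brick (cat (single s [b]) (single t [c])))
        (brick (cat (single s [b']) (single t [c']))) := by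
    intro b c b' c' hne
    by_cases hb : b = b'
    · subst hb
      exact disjoint_cat_cat _ (disjoint_single t fun hc => hne (by rw [hc]))
    · exact disjoint_cat (disjoint_single s hb) _ _
  cases b <;> cases c
  · exact swap_of_disjoint _ _ (hd (by simp)) (hd (by simp))
  · exact swap_one_left _
  · exact swap_one_right _
  · exact swap_of_disjoint _ _ (hd (by simp)) (hd (by simp))

/-- Twisting inside the halves leaves the first letter at `s`, while the global twist carries it to
`γ • s`. The baker's map makes up the difference. -/
theorem twistPerm_eq_mul (γ : G) (s : S) :
    twistPerm γ = baker s (γ • s) *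
      (onBrick (single s [false]) (twistPerm γ) * onBrick (single s [true]) (twistPerm γ)) := by
  ext1 x
  obtain ⟨b, κ, rfl⟩ := exists_brickMap_single s x
  refine Canon.apply_eq ((Canon.twistPerm γ).cut s [b]) ?_ (brickMap_mem _ _)
  have h1 : Canon (onBrick (single s [false]) (twistPerm γ) *
      onBrick (single s [true]) (twistPerm γ)) (single s [b]) (single s [b]) γ := by
    have h2 := (Canon.twistPerm γ).onBrick (single s [b])
    rw [cat_root] at h2
    cases b
    · simpa using (Canon.onBrick_of_disjoint (G := G) (twistPerm γ)
        (disjoint_single s (by simp))).comp h2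
    · simpa using h2.comp (Canon.onBrick_of_disjoint (G := G) (twistPerm γ)
        (disjoint_single s (by simp)))
  simpa [root_cat] using h1.comp (Canon.baker (G := G) s (γ • s) b)

theorem swap_mul_self (γ : G) (h : Disjoint (brick φ) (brick ψ)) :
    swap φ ψ γ h * swap φ ψ γ h = 1 := by
  ext1 x
  by_cases h1 : x ∈ brick φ
  · exact Canon.apply_eq (by simpa using (swap_left γ h).comp (swap_right γ h)) (.one φ) h1
  by_cases h2 : x ∈ brick ψ
  · exact Canon.apply_eq (by simpa using (swap_right γ h).comp (swap_left γ h)) (.one ψ) h2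
  rw [Equiv.Perm.mul_apply, swap_apply_of_notMem γ h h1 h2, swap_apply_of_notMem γ h h1 h2]
  rfl

end Elements

/-! ### What a normalized subgroup must contain. -/

section Normal

variable {G : Type u} {S : Type v} [Group G] [MulAction G S]
  {M : Subgroup (Equiv.Perm (CantorCube S))}

/-- If `f ∈ M` moves a set off itself, then `M` contains all commutators of elements supported
there. -/
theorem commutator_mem_of_moved (hM : ∀ p ∈ permGroup G S, ∀ m ∈ M, p * m * p⁻¹ ∈ M)
    {D : Set (CantorCube S)} {f g h : Equiv.Perm (CantorCube S)} (hf : f ∈ M)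
    (hD : ∀ x ∈ D, f x ∉ D) (hg : g ∈ permGroup G S) (hh : h ∈ permGroup G S)
    (hgD : ∀ x, x ∉ D → g x = x) (hhD : ∀ x, x ∉ D → h x = x) :
    g * h * g⁻¹ * h⁻¹ ∈ M := by
  have hc : g * f * g⁻¹ * f⁻¹ ∈ M := M.mul_mem (hM g hg f hf) (M.inv_mem hf)
  -- The supports $f(D)$ and $D$ are disjoint.
  have hcomm : Commute (f * g⁻¹ * f⁻¹) h := by
    refine Equiv.Perm.Disjoint.commute fun x => ?_
    by_cases hx : x ∈ D
    · left
      have h1 : f⁻¹ x ∉ D := fun h' => hD _ h' (by simpa using hx)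
      have h2 : g⁻¹ (f⁻¹ x) = f⁻¹ x := by rw [Equiv.Perm.inv_eq_iff_eq, hgD _ h1]
      rw [Equiv.Perm.mul_apply, Equiv.Perm.mul_apply, h2]
      exact f.apply_symm_apply x
    · exact .inr (hhD x hx)
  have key : (g * f * g⁻¹ * f⁻¹) * (h * (g * f * g⁻¹ * f⁻¹)⁻¹ * h⁻¹) ∈ M :=
    M.mul_mem hc (hM h hh _ (M.inv_mem hc))
  convert key using 1
  calc g * h * g⁻¹ * h⁻¹
      = g * (h * (f * g⁻¹ * f⁻¹)) * (f * g⁻¹ * f⁻¹)⁻¹ * g⁻¹ * h⁻¹ := by group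
    _ = g * ((f * g⁻¹ * f⁻¹) * h) * (f * g⁻¹ * f⁻¹)⁻¹ * g⁻¹ * h⁻¹ := by rw [hcomm.eq]
    _ = _ := by group

theorem swap_mem_of_moved (hM : ∀ p ∈ permGroup G S, ∀ m ∈ M, p * m * p⁻¹ ∈ M)
    {δ : S → List Bool} (hδ : FiniteSupport δ) {f : Equiv.Perm (CantorCube S)} (hf : f ∈ M)
    (hD : ∀ x ∈ brick δ, f x ∉ brick δ) (s : S) (γ : G) :
    swap (cat δ (single s [false])) (cat δ (single s [true])) γ
      (disjoint_cut δ s (by simp)) ∈ M := by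
  have h := disjoint_cut δ s (b := false) (c := true) (by simp)
  set A := cat δ (single s [false])
  set B := cat δ (single s [true])
  have hA : FiniteSupport A := hδ.cut s _
  have hB : FiniteSupport B := hδ.cut s _
  have hAδ : ∀ b t, brick (cat A (single t [b])) ⊆ brick δ := fun b t =>
    (brick_cat_subset _ _).trans (brick_cat_subset _ _)
  have hBδ : ∀ b t, brick (cat B (single t [b])) ⊆ brick δ := fun b t =>
    (brick_cat_subset _ _).trans (brick_cat_subset _ _)
  have hA' := disjoint_cut A s (b := false) (c := true) (by simp)
  have hB' := disjoint_cut B (γ • s) (b := false) (c := true) (by simp)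
  -- With subscripts for halves, `h` exchanges $A_0$ with $B_0$, and `g` exchanges $A_0$ with $A_1$
  -- and $B_0$ with $B_1$. Then $ghg^{-1}$ exchanges $A_1$ with $B_1$, so $[g,h]^{-1}$ is the full
  -- exchange of $A$ and $B$.
  have key := commutator_mem_of_moved hM hf hD
    (h := swap (cat A (single s [false])) (cat B (single (γ • s) [false])) γ (disjoint_cat h _ _))
    (g := swap (cat A (single s [false])) (cat A (single s [true])) (1 : G) hA' *
      swap (cat B (single (γ • s) [false])) (cat B (single (γ • s) [true])) (1 : G) hB')
    (mul_mem (swap_mem_permGroup (hA.cut _ _) (hA.cut _ _) _ _)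
      (swap_mem_permGroup (hB.cut _ _) (hB.cut _ _) _ _))
    (swap_mem_permGroup (hA.cut _ _) (hB.cut _ _) _ _)
    (fun x hx => by
      rw [Equiv.Perm.mul_apply,
        swap_apply_of_notMem 1 hB' (fun h => hx (hBδ _ _ h)) (fun h => hx (hBδ _ _ h)),
        swap_apply_of_notMem 1 hA' (fun h => hx (hAδ _ _ h)) (fun h => hx (hAδ _ _ h))])
    (fun x hx => swap_apply_of_notMem γ _ (fun h => hx (hAδ _ _ h)) (fun h => hx (hBδ _ _ h)))
  rw [swap_conj γ (disjoint_cat h _ _) (disjoint_cat h _ _)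
    ((swap_of_disjoint 1 hB' (disjoint_cat h _ _) (disjoint_cat h _ _)).comp_one
      (swap_one_left hA'))
    ((swap_one_left hB').comp_one
      (swap_of_disjoint 1 hA' (disjoint_cat h.symm _ _) (disjoint_cat h.symm _ _)))] at key
  rw [swap_eq_mul γ s h]
  have := M.inv_mem key
  rwa [mul_inv_rev, inv_inv, inv_eq_of_mul_eq_one_right (swap_mul_self γ _)] at this

/-- Some letter `n` at some coordinate `s` differs between `x` and `f x`. On a small enough brick
around `x`, both this letter of the point and this letter of its image are constant, so the brick
cannot meet its image. -/
theorem exists_moved_brick {f : Equiv.Perm (CantorCube S)} (hf : f ∈ permGroup G S)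
    (hne : f ≠ 1) : ∃ δ, FiniteSupport δ ∧ ∀ x ∈ brick δ, f x ∉ brick δ := by
  classical
  obtain ⟨x, hx⟩ : ∃ x, f x ≠ x := by
    by_contra! h
    exact hne (Equiv.ext h)
  obtain ⟨s, hs⟩ := Function.ne_iff.1 hx
  obtain ⟨n, hn⟩ := Function.ne_iff.1 hs
  obtain ⟨φ, ψ, γ, hφ, hψ, hxφ, h⟩ := isLocallyCanon_of_mem hf x
  obtain ⟨κ, rfl⟩ := mem_brick_iff.1 hxφ
  -- Coordinate `s` of the image is read from coordinate `γ⁻¹ • s` of the source, so both are fixed.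
  -- Prefixing words only shifts letters to the right, so `n + 1` letters determine the letter at
  -- position `n`.
  set a : S → List Bool := fun r =>
    if r = s ∨ r = γ⁻¹ • s then List.ofFn fun i : Fin (n + 1) => κ r i else [] with ha
  have haf : FiniteSupport a := by
    refine (Set.toFinite {s, γ⁻¹ • s}).subset fun r hr => ?_
    by_contra h'
    exact hr (if_neg h')
  have hval : ∀ (w : List Bool) (r : S) (μ : CantorCube S), (r = s ∨ r = γ⁻¹ • s) →
      prepend w (brickMap a μ r) n = prepend w (κ r) n := by
    intro w r μ hr
    simp only [prepend]
    split_ifs with h1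
    · rfl
    · have hl : (a r).length = n + 1 := by simp [ha, hr]
      have : n - w.length < (a r).length := by omega
      have hn : (a r)[n - w.length] = κ r (n - w.length) := by
        simp only [ha, if_pos hr, List.getElem_ofFn]
      rw [← hn]
      exact dif_pos this
  refine ⟨cat φ a, hφ.cat haf, fun y hy hfy => hn ?_⟩
  obtain ⟨μ, rfl⟩ := mem_brick_iff.1 hy
  obtain ⟨ν, hν⟩ := mem_brick_iff.1 hfy
  have h2 : f (brickMap φ κ) s n = f (brickMap (cat φ a) μ) s n := by
    rw [brickMap_cat, h, h]
    exact (hval (ψ s) (γ⁻¹ • s) μ (.inr rfl)).symm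
  rw [h2, ← hν, brickMap_cat]
  exact hval (φ s) s ν (.inl rfl)

theorem swap_mem_of_exists_disjoint (hM : ∀ p ∈ permGroup G S, ∀ m ∈ M, p * m * p⁻¹ ∈ M)
    [Nonempty S] {δ : S → List Bool} (hδ : FiniteSupport δ) {f : Equiv.Perm (CantorCube S)}
    (hf : f ∈ M) (hD : ∀ x ∈ brick δ, f x ∉ brick δ)
    {φ ψ ε : S → List Bool} (hφ : FiniteSupport φ) (hψ : FiniteSupport ψ) (hε : FiniteSupport ε)
    (h : Disjoint (brick φ) (brick ψ)) (hφε : Disjoint (brick ε) (brick φ))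
    (hψε : Disjoint (brick ε) (brick ψ)) (γ : G) : swap φ ψ γ h ∈ M := by
  obtain ⟨s⟩ := ‹Nonempty S›
  -- The moved brick is relocated into the free brick `ε`: by passing to the intersection if the two
  -- meet, and otherwise by conjugating `f` with their exchange.
  obtain ⟨δ, hδ, f, hf, hD, h1, h2⟩ : ∃ δ, FiniteSupport δ ∧ ∃ f ∈ M,
      (∀ x ∈ brick δ, f x ∉ brick δ) ∧ Disjoint (brick δ) (brick φ) ∧
      Disjoint (brick δ) (brick ψ) := by
    by_cases hi : (brick ε ∩ brick δ).Nonempty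
    · have hb := brick_meet hi
      have hs := hb ▸ Set.inter_subset_left (s := brick ε) (t := brick δ)
      refine ⟨meet ε δ, hε.append (hδ.drop _), f, hf, ?_, hφε.mono_left hs, hψε.mono_left hs⟩
      rw [hb]
      exact fun x hx hfx => hD x hx.2 hfx.2
    · have hd : Disjoint (brick ε) (brick δ) :=
        Set.disjoint_iff_inter_eq_empty.2 (Set.not_nonempty_iff_eq_empty.1 hi)
      refine ⟨ε, hε, _, hM _ (swap_mem_permGroup hε hδ (1 : G) hd) f hf, ?_, hφε, hψε⟩
      intro x hx hfx
      have hinv := inv_eq_of_mul_eq_one_right (swap_mul_self (1 : G) hd)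
      rw [hinv, Equiv.Perm.mul_apply, Equiv.Perm.mul_apply,
        (swap_one_right (G := G) hd).apply_mem_iff] at hfx
      exact hD _ (((swap_one_left (G := G) hd).apply_mem_iff x).2 hx) hfx
  have hd := disjoint_cut δ s (b := false) (c := true) (by simp)
  have hA := disjoint_cat_left h1 (single s [false])
  have hB := disjoint_cat_left h2 (single s [true])
  -- This product carries the two halves of $B(\delta)$ to $B(\varphi)$ and $B(\psi)$.
  have hc := mul_mem (swap_mem_permGroup (hδ.cut s _) hφ (1 : G) hA)
    (swap_mem_permGroup (hδ.cut s _) hψ (1 : G) hB)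
  have := hM _ hc _ (swap_mem_of_moved hM hδ hf hD s γ)
  rwa [swap_conj γ hd h
    ((swap_of_disjoint 1 hB hd (disjoint_cat_left h2 _)).comp_one (swap_one_left hA))
    ((swap_one_left hB).comp_one
      (swap_of_disjoint 1 hA (disjoint_cat_left h2 _).symm h.symm))] at this

theorem swap_mem (hM : ∀ p ∈ permGroup G S, ∀ m ∈ M, p * m * p⁻¹ ∈ M) [Nonempty S]
    (hne : ∃ f ∈ M, f ∈ permGroup G S ∧ f ≠ 1)
    {φ ψ : S → List Bool} (hφ : FiniteSupport φ) (hψ : FiniteSupport ψ)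
    (h : Disjoint (brick φ) (brick ψ)) (γ : G) : swap φ ψ γ h ∈ M := by
  obtain ⟨f, hf, hfG, hf1⟩ := hne
  obtain ⟨δ, hδ, hD⟩ := exists_moved_brick hfG hf1
  obtain ⟨s⟩ := ‹Nonempty S›
  have : Nonempty S := ⟨s⟩
  -- The bricks may fill the whole cube. Exchanging one pair of halves at a time leaves the other
  -- half of $B(\varphi)$ free.
  rw [swap_eq_mul γ s h]
  exact M.mul_mem
    (swap_mem_of_exists_disjoint hM hδ hf hD (hφ.cut _ _) (hψ.cut _ _) (hφ.cut s [true]) _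
      (disjoint_cut φ s (by simp)) (disjoint_cat h _ _) γ)
    (swap_mem_of_exists_disjoint hM hδ hf hD (hφ.cut _ _) (hψ.cut _ _) (hφ.cut s [false]) _
      (disjoint_cut φ s (by simp)) (disjoint_cat h _ _) γ)

/-- If a normal subgroup contains all exchanges of bricks, and modulo it `g` acting on a brick is
equivalent to `g` acting on each of its halves, then it contains `g` acting on any brick. -/
theorem onBrick_mem (hM : ∀ p ∈ permGroup G S, ∀ m ∈ M, p * m * p⁻¹ ∈ M)
    (hswap : ∀ {φ ψ : S → List Bool} (_ : FiniteSupport φ) (_ : FiniteSupport ψ)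
      (h : Disjoint (brick φ) (brick ψ)), swap φ ψ (1 : G) h ∈ M)
    {g : Equiv.Perm (CantorCube S)} (hg : g ∈ permGroup G S) (s : S)
    (hmul : ∀ φ : S → List Bool, FiniteSupport φ → ∃ m ∈ M, onBrick φ g =
      m * (onBrick (cat φ (single s [false])) g * onBrick (cat φ (single s [true])) g))
    {φ : S → List Bool} (hφ : FiniteSupport φ) : onBrick φ g ∈ M := by
  have hdisj : ∀ {φ ψ : S → List Bool}, FiniteSupport φ → FiniteSupport ψ →
      Disjoint (brick φ) (brick ψ) → onBrick ψ g * (onBrick φ g)⁻¹ ∈ M := by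
    intro φ ψ hφ hψ h
    have hs := hswap hφ hψ h
    rw [← onBrick_conj (swap_one_left (G := G) h) g]
    have := M.mul_mem hs (hM _ (onBrick_mem_permGroup hφ hg) _ (M.inv_mem hs))
    simpa only [mul_assoc] using this
  have hproper : ∀ {φ ψ : S → List Bool}, FiniteSupport φ → FiniteSupport ψ →
      Disjoint (brick φ) (brick ψ) → onBrick φ g ∈ M := by
    intro φ ψ hφ hψ h
    obtain ⟨m, hm, e⟩ := hmul φ hφ
    have h0 := hdisj hψ hφ h.symm
    have h1 := hdisj hψ (hφ.cut s [false]) (disjoint_cat_left h _).symm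
    have h2 := hdisj hψ (hφ.cut s [true]) (disjoint_cat_left h _).symm
    have h3 := hM _ (onBrick_mem_permGroup hψ hg) _ h2
    have h4 := M.mul_mem (M.inv_mem (M.mul_mem (M.mul_mem hm h1) h3)) h0
    -- Up to the noncommutative bookkeeping in `h3`, this is $x=x^2$: the product in `h4` telescopes
    -- to the copy of `g` in $B(\psi)$.
    have h5 : onBrick ψ g ∈ M := by
      rw [e] at h4
      convert h4 using 1
      group
    simpa using M.mul_mem h0 h5
  -- A brick that is the whole cube has no disjoint partner, but its two halves are partners of each
  -- other.
  obtain ⟨m, hm, e⟩ := hmul φ hφ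
  have hd := disjoint_cut φ s (b := false) (c := true) (by simp)
  rw [e]
  exact M.mul_mem hm (M.mul_mem (hproper (hφ.cut _ _) (hφ.cut _ _) hd)
    (hproper (hφ.cut _ _) (hφ.cut _ _) hd.symm))

end Normal

end TwistedBrinThompson

namespace TwistedBrinThompson

/-! ### Generation by exchanges, baker's maps and twists; conclusion. -/

section Generation

variable {G : Type u} {S : Type v} [Group G] [MulAction G S]
  {M : Subgroup (Equiv.Perm (CantorCube S))}

theorem forall₂_comp {α β γ : Type*} {R : α → β → Prop} {Q : β → γ → Prop} {P : α → γ → Prop}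
    (h : ∀ a b c, R a b → Q b c → P a c) {l : List α} {m : List β} {n : List γ}
    (h1 : List.Forall₂ R l m) (h2 : List.Forall₂ Q m n) : List.Forall₂ P l n := by
  induction h1 generalizing n with
  | nil => cases h2; exact .nil
  | cons hab _ ih =>
    cases h2 with
    | cons hbc h2 => exact .cons (h _ _ _ hab hbc) (ih h2)

theorem forall₂_canon_of_mem {p : Equiv.Perm (CantorCube S)} {l : List (S → List Bool)}
    (h : ∀ φ ∈ l, Canon p φ φ (1 : G)) :
    List.Forall₂ (fun φ ψ => Canon p φ ψ (1 : G)) l l :=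
  List.forall₂_same.2 h

/-- A refinement of the domain induces one of the image. -/
theorem exists_cut_image {p : Equiv.Perm (CantorCube S)} {l m T : List (S → List Bool)}
    (h : List.Forall₂ (fun φ ψ => ∃ γ : G, Canon p φ ψ γ) l m) (hT : Cut l T) :
    ∃ U, Cut m U ∧ List.Forall₂ (fun φ ψ => ∃ γ : G, Canon p φ ψ γ) T U := by
  induction hT with
  | refl => exact ⟨m, .refl, h⟩
  | cut t _ ih =>
    obtain ⟨U, hU, hF⟩ := ih
    cases hF with
    | cons h1 h2 =>
      obtain ⟨γ, hγ⟩ := h1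
      exact ⟨_, hU.cut (γ • t), .cons ⟨γ, hγ.cut t _⟩ (.cons ⟨γ, hγ.cut t _⟩ h2)⟩
  | perm _ hp ih =>
    obtain ⟨U, hU, hF⟩ := ih
    obtain ⟨V, hV1, hV2⟩ := List.perm_comp_forall₂ hp.symm hF
    exact ⟨V, hU.perm hV2.symm, hV1⟩

/-- The clause on bricks `χ` outside the list carries the induction: it guarantees that a head brick
stays fixed while the tail is permuted. -/
theorem exists_perm_mem
    (hswap : ∀ {φ ψ : S → List Bool} (_ : FiniteSupport φ) (_ : FiniteSupport ψ)
      (h : Disjoint (brick φ) (brick ψ)), swap φ ψ (1 : G) h ∈ M)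
    {l m : List (S → List Bool)} (h : l.Perm m) (hl : IsDisjointList l) :
    ∃ w ∈ M, List.Forall₂ (fun φ ψ => Canon w φ ψ (1 : G)) l m ∧
      ∀ χ : S → List Bool, (∀ φ ∈ l, Disjoint (brick χ) (brick φ)) → Canon w χ χ (1 : G) := by
  induction h with
  | nil => exact ⟨1, M.one_mem, .nil, fun χ _ => .one χ⟩
  | cons a _ ih =>
    obtain ⟨w, hw, h1, h2⟩ := ih hl.of_cons
    exact ⟨w, hw, .cons (h2 a fun φ hφ => hl.disjoint_head hφ) h1,
      fun χ hχ => h2 χ fun φ hφ => hχ φ (List.mem_cons_of_mem _ hφ)⟩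
  | swap a b l =>
    have hd := hl.disjoint_head (ψ := a) (by simp)
    refine ⟨swap b a (1 : G) hd, hswap (hl.finiteSupport b (by simp))
      (hl.finiteSupport a (by simp)) hd, .cons ?_ (.cons ?_ (forall₂_canon_of_mem ?_)), ?_⟩
    · exact swap_one_left hd
    · exact swap_one_right hd
    · exact fun φ hφ => swap_of_disjoint 1 hd (hl.disjoint_head (by simp [hφ])).symm
        (hl.of_cons.disjoint_head hφ).symm
    · exact fun χ hχ => swap_of_disjoint 1 hd (hχ b (by simp)) (hχ a (by simp))
  | trans h1 _ ih1 ih2 =>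
    obtain ⟨w, hw, a1, a2⟩ := ih1 hl
    obtain ⟨w', hw', b1, b2⟩ := ih2 (hl.perm h1)
    exact ⟨w' * w, M.mul_mem hw' hw, forall₂_comp (fun _ _ _ => Canon.comp_one) a1 b1,
      fun χ hχ => (a2 χ hχ).comp_one (b2 χ fun φ hφ => hχ φ (h1.mem_iff.2 hφ))⟩

/-- The partition obtained from the cube by halving the first brick `n` times along `s`. -/
noncomputable def comb (s : S) : ℕ → (S → List Bool) × List (S → List Bool)
  | 0 => (root, [])
  | n + 1 => (cat (comb s n).1 (single s [false]),
      cat (comb s n).1 (single s [true]) :: (comb s n).2)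

theorem length_comb (s : S) (n : ℕ) : (comb s n).2.length = n := by
  induction n with
  | zero => rfl
  | succ n ih => simp [comb, ih]

/-- The comb depends only on the number of pieces, so it links any two halving partitions of equal
size. When a partition halves its head $B(\varphi)$ along `t`, the comb halves its own head along
`s`, and the baker's map inside $B(\varphi)$ converts one halving into the other. -/
theorem exists_comb_mem
    (hswap : ∀ {φ ψ : S → List Bool} (_ : FiniteSupport φ) (_ : FiniteSupport ψ)
      (h : Disjoint (brick φ) (brick ψ)), swap φ ψ (1 : G) h ∈ M)
    (hbaker : ∀ φ : S → List Bool, FiniteSupport φ → ∀ s t, onBrick φ (baker s t) ∈ M)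
    (s : S) {T : List (S → List Bool)} (hT : Cut [root] T) :
    ∃ n, ∃ g ∈ M, List.Forall₂ (fun φ ψ => Canon g φ ψ (1 : G))
      ((comb s n).1 :: (comb s n).2) T := by
  induction hT with
  | refl => exact ⟨0, 1, M.one_mem, .cons (.one _) .nil⟩
  | @cut φ r t hc ih =>
    obtain ⟨n, g, hg, hF⟩ := ih
    have hd := isDisjointList_root.cut hc
    cases hF with
    | cons h1 h2 =>
      have hb : ∀ b, Canon (onBrick φ (baker s t) * g) (cat (comb s n).1 (single s [b]))
          (cat φ (single t [b])) (1 : G) := fun b =>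
        (h1.cut_one s [b]).comp_one ((Canon.baker s t b).onBrick φ)
      refine ⟨n + 1, onBrick φ (baker s t) * g,
        M.mul_mem (hbaker φ (hd.finiteSupport φ (by simp)) s t) hg,
        .cons (hb false) (.cons (hb true) ?_)⟩
      exact forall₂_comp (fun _ _ _ => Canon.comp_one) h2 (forall₂_canon_of_mem fun ψ hψ =>
        Canon.onBrick_of_disjoint _ (hd.disjoint_head hψ).symm)
  | perm hc hp ih =>
    obtain ⟨n, g, hg, hF⟩ := ih
    obtain ⟨w, hw, h1, -⟩ := exists_perm_mem hswap hp (isDisjointList_root.cut hc)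
    exact ⟨n, w * g, M.mul_mem hw hg, forall₂_comp (fun _ _ _ => Canon.comp_one) hF h1⟩

theorem mem_of_canon_self
    (htwist : ∀ φ : S → List Bool, FiniteSupport φ → ∀ γ : G, onBrick φ (twistPerm γ) ∈ M)
    {l : List (S → List Bool)} (hl : IsDisjointList l) {p : Equiv.Perm (CantorCube S)}
    (hp : ∀ φ ∈ l, ∃ γ : G, Canon p φ φ γ) (h : ∀ x, (∀ φ ∈ l, x ∉ brick φ) → p x = x) :
    p ∈ M := by
  induction l generalizing p with
  | nil =>
    have : p = 1 := Equiv.ext fun x => h x (by simp)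
    exact this ▸ M.one_mem
  | cons a l ih =>
    obtain ⟨γ, hγ⟩ := hp a (by simp)
    have ha := htwist a (hl.finiteSupport a (by simp)) γ
    have hc : Canon (onBrick a (twistPerm γ)) a a γ := by
      simpa [cat_root] using (Canon.twistPerm γ).onBrick a
    -- Undoing the twist on the head makes `p` the identity there, so the tail alone remains.
    have : p * (onBrick a (twistPerm γ))⁻¹ ∈ M := by
      refine ih hl.of_cons (fun φ hφ => ?_) fun x hx => ?_
      · obtain ⟨δ, hδ⟩ := hp φ (List.mem_cons_of_mem _ hφ)
        exact ⟨_, (Canon.onBrick_of_disjoint (G := G) (twistPerm γ)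
          (hl.disjoint_head hφ).symm).inv_one.comp hδ⟩
      · by_cases hxa : x ∈ brick a
        · have h1 := hc.inv.comp hγ
          rw [mul_inv_cancel] at h1
          exact h1.apply_of_mem hxa
        · rw [Equiv.Perm.mul_apply, Equiv.Perm.inv_eq_iff_eq.2
            (onBrick_apply_of_notMem a (twistPerm γ) hxa).symm]
          exact h x (List.forall_mem_cons.2 ⟨hxa, hx⟩)
    simpa using M.mul_mem this ha

/-- Exchanges of bricks, baker's maps on bricks and twists of bricks generate the twisted
Brin–Thompson group. -/
theorem permGroup_le [Nonempty S]
    (hswap : ∀ {φ ψ : S → List Bool} (_ : FiniteSupport φ) (_ : FiniteSupport ψ)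
      (h : Disjoint (brick φ) (brick ψ)), swap φ ψ (1 : G) h ∈ M)
    (hbaker : ∀ φ : S → List Bool, FiniteSupport φ → ∀ s t, onBrick φ (baker s t) ∈ M)
    (htwist : ∀ φ : S → List Bool, FiniteSupport φ → ∀ γ : G, onBrick φ (twistPerm γ) ∈ M) :
    permGroup G S ≤ M := by
  intro f hf
  obtain ⟨s⟩ := ‹Nonempty S›
  obtain ⟨n, φ, ψ, γ, h⟩ := mem_permGroup_iff.1 hf
  have hlist : ∀ {φ : Fin n → S → List Bool}, IsBrickPartition φ →
      IsDisjointList (List.ofFn φ) ∧ Covers (List.ofFn φ) := by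
    intro φ hφ
    refine ⟨⟨?_, List.pairwise_ofFn.2 fun i j hij => hφ.disjoint i j hij.ne⟩, fun x => ?_⟩
    · simp only [List.forall_mem_ofFn_iff]
      exact hφ.finiteSupport
    · obtain ⟨i, hi⟩ := Set.mem_iUnion.1 (hφ.cover ▸ Set.mem_univ x)
      exact ⟨φ i, List.mem_ofFn.2 ⟨i, rfl⟩, hi⟩
  have hF : List.Forall₂ (fun φ ψ => ∃ γ : G, Canon f φ ψ γ) (List.ofFn φ) (List.ofFn ψ) := by
    refine List.forall₂_iff_get.2 ⟨by simp, fun i h1 h2 => ?_⟩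
    simp only [List.get_eq_getElem, List.getElem_ofFn]
    exact ⟨_, h.map_brick _⟩
  obtain ⟨hφ1, hφ2⟩ := hlist h.domain
  obtain ⟨hψ1, hψ2⟩ := hlist h.image
  -- The domain is refined to the halving partition `T`, with image `U`; then `U` is refined to the
  -- halving partition `V`. Pulling `V` back gives `W`, which is still obtained by halving because
  -- it cuts `T`.
  obtain ⟨T, hT, hT'⟩ := exists_cut_of_covers hφ1 hφ2
  obtain ⟨U, hU, hTU⟩ := exists_cut_image hF hT'
  obtain ⟨V, hV, hUV⟩ := exists_cut_of_covers (hψ1.cut hU) (hψ2.cut hU)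
  have hUT : List.Forall₂ (fun φ ψ => ∃ γ : G, Canon f⁻¹ φ ψ γ) U T :=
    (hTU.imp fun _ _ ⟨γ, hγ⟩ => (⟨γ⁻¹, hγ.inv⟩ : ∃ γ : G, Canon f⁻¹ _ _ γ)).flip
  obtain ⟨W, hW, hVW⟩ := exists_cut_image hUT hUV
  obtain ⟨k, g, hg, hgF⟩ := exists_comb_mem hswap hbaker s hV
  obtain ⟨k', g', hg', hgF'⟩ := exists_comb_mem hswap hbaker s (hT.trans hW)
  have hk : k = k' := by
    have := (hgF.length_eq.trans hVW.length_eq).trans hgF'.length_eq.symm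
    simpa [length_comb] using this
  subst hk
  have h1 : List.Forall₂ (fun φ ψ => Canon (g' * g⁻¹) φ ψ (1 : G)) V W :=
    forall₂_comp (fun _ _ _ => Canon.comp_one)
      (hgF.imp fun _ _ h => h.inv_one).flip hgF'
  have h2 : List.Forall₂ (fun φ ψ => ∃ γ : G, Canon f φ ψ γ) W V :=
    (hVW.imp fun _ _ ⟨γ, hγ⟩ => (⟨γ⁻¹, by simpa using hγ.inv⟩ : ∃ γ : G, Canon f _ _ γ)).flip
  have h4 : List.Forall₂ (fun φ ψ => ∃ γ : G, Canon (f * (g' * g⁻¹)) φ ψ γ) V V :=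
    forall₂_comp (fun _ _ _ h ⟨γ, hγ⟩ => ⟨_, h.comp hγ⟩) h1 h2
  -- Here $g'g^{-1}$ carries `V` to `W` through the comb and `f` carries `W` back to `V`, so the
  -- product preserves every brick of `V` up to a twist.
  have h5 : f * (g' * g⁻¹) ∈ M := by
    refine mem_of_canon_self htwist (isDisjointList_root.cut hV)
      (List.forall₂_same.1 h4) fun x hx => ?_
    obtain ⟨φ, hφ, hxφ⟩ := covers_root.cut hV x
    exact absurd hxφ (hx φ hφ)
  have h6 := M.mul_mem h5 (M.inv_mem (M.mul_mem hg' (M.inv_mem hg)))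
  simpa only [mul_inv_cancel_right] using h6

/-- A subgroup normalized by the twisted Brin–Thompson group and meeting it nontrivially contains
it. -/
theorem permGroup_le_of_normalized [Nonempty S]
    (hM : ∀ p ∈ permGroup G S, ∀ m ∈ M, p * m * p⁻¹ ∈ M)
    (hne : ∃ f ∈ M, f ∈ permGroup G S ∧ f ≠ 1) : permGroup G S ≤ M := by
  have hswap : ∀ {φ ψ : S → List Bool} (_ : FiniteSupport φ) (_ : FiniteSupport ψ)
      (h : Disjoint (brick φ) (brick ψ)), swap φ ψ (1 : G) h ∈ M :=
    fun hφ hψ h => swap_mem hM hne hφ hψ h 1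
  have hbaker : ∀ φ : S → List Bool, FiniteSupport φ → ∀ s t, onBrick φ (baker s t) ∈ M := by
    intro φ hφ s t
    by_cases hst : s = t
    · rw [hst, baker_self, map_one]
      exact M.one_mem
    · refine onBrick_mem hM hswap (baker_mem_permGroup G s t) s (fun φ hφ => ?_) hφ
      have hd := disjoint_cat (disjoint_single s (b := false) (c := true) (by simp))
        (single t [true]) (single t [false])
      refine ⟨onBrick φ (swap _ _ (1 : G) hd), ?_,
        (congrArg (onBrick φ) (baker_eq_mul G hst hd)).trans ?_⟩
      · rw [onBrick_swap]
        exact hswap (hφ.cat ((FiniteSupport.single s _).cut t _))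
          (hφ.cat ((FiniteSupport.single s _).cut t _)) _
      · rw [map_mul, map_mul, ← onBrick_cat, ← onBrick_cat]
  refine permGroup_le hswap hbaker fun φ hφ γ => ?_
  obtain ⟨s⟩ := ‹Nonempty S›
  -- Twists come after baker's maps, because the correcting factor for a twist is a baker's map
  -- inside $B(\varphi)$.
  refine onBrick_mem hM hswap (twistPerm_mem_permGroup γ) s (fun φ hφ => ?_) hφ
  refine ⟨_, hbaker φ hφ s (γ • s), (congrArg (onBrick φ) (twistPerm_eq_mul γ s)).trans ?_⟩
  rw [map_mul, map_mul, ← onBrick_cat, ← onBrick_cat]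

theorem toPerm_injective (X : Type v) [TopologicalSpace X] : Function.Injective (toPerm X) :=
  Homeomorph.toEquiv_injective

theorem nontrivial_twistedBrinThompsonGroup [Nonempty S] :
    Nontrivial (twistedBrinThompsonGroup G S) := by
  obtain ⟨s⟩ := ‹Nonempty S›
  have hd := disjoint_single s (b := false) (c := true) (by simp)
  obtain ⟨f, hf, e⟩ := swap_mem_permGroup (.single s _) (.single s _) (1 : G) hd
  refine ⟨⟨f, hf⟩, 1, fun h => ?_⟩
  have hf1 : f = 1 := congrArg Subtype.val h
  rw [hf1, map_one] at e
  obtain ⟨x, hx⟩ := brick_nonempty (single s [false])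
  have := ((swap_one_left (G := G) hd).apply_mem_iff x).2 hx
  rw [← e] at this
  exact Set.disjoint_left.1 hd hx this

end Generation

end TwistedBrinThompson

open TwistedBrinThompson in
theorem mainTheorem9 (G : Type u) (S : Type v) [Group G] [MulAction G S] [FaithfulSMul G S]
    [Nonempty S] : IsSimpleGroup (twistedBrinThompsonGroup G S) := by
  refine { nontrivial_twistedBrinThompsonGroup with eq_bot_or_eq_top_of_normal := ?_ }
  intro N hN
  refine or_iff_not_imp_left.2 fun hbot => ?_
  obtain ⟨⟨n, hn⟩, hn1⟩ := N.ne_bot_iff_exists_ne_one.1 hbot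
  set ι := (toPerm (CantorCube S)).comp (twistedBrinThompsonGroup G S).subtype
  have hι : Function.Injective ι := (toPerm_injective _).comp Subtype.val_injective
  -- The image of `N` among the permutations of the cube is normalized by the whole group and
  -- nontrivial.
  have hle : permGroup G S ≤ N.map ι := by
    refine permGroup_le_of_normalized ?_ ⟨ι n, ⟨n, hn, rfl⟩, ⟨_, n.2, rfl⟩, ?_⟩
    · rintro _ ⟨p, hp, rfl⟩ _ ⟨m, hm, rfl⟩
      exact ⟨⟨p, hp⟩ * m * ⟨p, hp⟩⁻¹, hN.conj_mem m hm _, by simp [ι]⟩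
    · rw [← map_one ι]
      exact fun h => hn1 (Subtype.ext (hι h))
  refine (Subgroup.eq_top_iff' N).2 fun f => ?_
  obtain ⟨m, hm, e⟩ := hle ⟨f.1, f.2, rfl⟩
  exact hι e ▸ hm
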